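/- Let $M$ be a locally compact Hausdorff space, $\mu$ a $\sigma$-finite Borel measure on $M$ with full support, and $X=\{X_t,t\ge 0;\ \mathbb P_x, x\in M\}$ a $\mu$-symmetric strong Markov process on $M$ (possibly with a finite lifetime) whose transition semigroup $T_tf(x)=\mathbb E_x[f(X_t)]$ is strongly continuous on $L^2(M;\mu)$; let $(\mathcal L,\mathcal D(\mathcal L))$ be its infinitesimal generator in $L^2(M;\mu)$. Let $S=\{S_t\}_{t\ge 0}$ be a driftless subordinator with Laplace exponent $\phi(\lambda)=\int_{(0,\infty)}(1-e^{-\lambda s})\,\nu(ds)$, where the Lévy measure $\nu$ satisfies $\int_{(0,\infty)}(1\wedge s)\,\nu(ds)<\infty$ and $\nu(0,\infty)=\infty$. Put $w(s)=\nu(s,\infty)$ for $s>0$ and $E_t=\inf\{s>0: S_s>t\}$ for $t\ge 0$. For $f\in L^2(M;\mu)$ and $u:[0,\infty)\to L^2(M;\mu)$, call $u$ a weak solution of $$\partial_t^w u=\mathcal L u,\qquad u(0)=f,$$ if $u(0)=f$, and (i) $t\mapsto u(t)$ is continuous from $[0,\infty)$ to $L^2(M;\mu)$ (consequently $I_t^w(u):=\int_0^t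 w(t-s)\,(u(s)-f)\,ds$ converges absolutely in $L^2(M;\mu)$ for every $t>0$); (ii) for every $g\in\mathcal D(\mathcal L)$ and every $t>0$, the derivative on the left exists and $$\frac{d}{dt}\int_M g(x)\,I_t^w(u)(x)\,\mu(dx)=\int_M u(t,x)\,\mathcal L g(x)\,\mu(dx).$$ Then, for every $f\in L^2(M;\mu)$: the expectation $u(t)=\mathbb E[T_{E_t}f]$ (over $S$, as a Bochner integral in $L^2(M;\mu)$) exists for every $t\ge 0$; $u$ is a weak solution, and $I^w_t(u)$ converges absolutely in $L^2(M;\mu)$ for every $t>0$. Conversely, every weak solution $v$ with initial value $f$ satisfies $v(t,x)=\mathbb E[T_{E_t}f](x)$ for $\mu$-a.e. $x\in M$, for every $t\ge 0$. -/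

import Mathlib

open MeasureTheory ProbabilityTheory Set Filter Topology
open scoped ENNReal NNReal

/-- A (temporally homogeneous) strong Markov process on `M`, realised on the sample space `Ω`.
The state space is enlarged by a cemetery point `∂ = Sum.inr ()`, so that a finite lifetime is
allowed (processes with infinite lifetime are those that never visit `∂`).  `P x` is the law of the
process started from `x`.  The strong Markov property is required at all stopping times of the
given filtration.  No path regularity is imposed, so in particular right-continuous strong Markov
processes are covered. -/
structure StrongMarkovProcess (M Ω : Type*) [MeasurableSpace M] [mΩ : MeasurableSpace Ω] where
  /-- the coordinate maps -/
  X : ℝ≥0 → Ω → M ⊕ Unit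
  /-- the filtration -/
  𝓕 : Filtration ℝ≥0 mΩ
  /-- the law of the process started at a given point -/
  P : M ⊕ Unit → Measure Ω
  isProbabilityMeasure : ∀ x, IsProbabilityMeasure (P x)
  adapted : ∀ t, Measurable[𝓕 t] (X t)
  start : ∀ x, ∀ᵐ ω ∂P x, X 0 ω = x
  absorbed : ∀ s t ω, s ≤ t → X s ω = Sum.inr () → X t ω = Sum.inr ()
  measurable_prob : ∀ t B, MeasurableSet B → Measurable fun x => P x (X t ⁻¹' B)
  measurable_stopped : ∀ (τ : Ω → WithTop ℝ≥0) (hτ : IsStoppingTime 𝓕 τ) (B : Set (M ⊕ Unit)),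
    MeasurableSet B → MeasurableSet[hτ.measurableSpace] {ω | τ ω ≠ ⊤ ∧ X ((τ ω).untopD 0) ω ∈ B}
  strong_markov : ∀ (τ : Ω → WithTop ℝ≥0) (hτ : IsStoppingTime 𝓕 τ) (t : ℝ≥0) (x : M ⊕ Unit)
    (B : Set (M ⊕ Unit)) (A : Set Ω), MeasurableSet B → MeasurableSet[hτ.measurableSpace] A →
    A ⊆ {ω | τ ω ≠ ⊤} →
    P x (A ∩ {ω | X ((τ ω).untopD 0 + t) ω ∈ B}) =
      ∫⁻ ω in A, P (X ((τ ω).untopD 0) ω) (X t ⁻¹' B) ∂P x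

namespace StrongMarkovProcess

variable {M Ω : Type*} [MeasurableSpace M] [MeasurableSpace Ω]

lemma measurableEmbedding_inl : MeasurableEmbedding (Sum.inl : M → M ⊕ Unit) :=
  ⟨Sum.inl_injective, measurable_inl, fun _ hs => measurableSet_inl_image.2 hs⟩

lemma measurable_X (X : StrongMarkovProcess M Ω) (t : ℝ≥0) : Measurable (X.X t) :=
  (X.adapted t).mono (X.𝓕.le t) le_rfl

lemma transition_apply (X : StrongMarkovProcess M Ω) (t : ℝ≥0) (x : M) {B : Set M}
    (hB : MeasurableSet B) :
    (((X.P (Sum.inl x)).map (X.X t)).comap Sum.inl) B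
      = X.P (Sum.inl x) (X.X t ⁻¹' (Sum.inl '' B)) := by
  rw [measurableEmbedding_inl.comap_apply,
    Measure.map_apply (X.measurable_X t) (measurableSet_inl_image.2 hB)]

/-- The transition kernel on `M`: `kernel t x B = P_x (X_t ∈ B)` (a sub-probability kernel, mass
being lost when the process has moved to the cemetery). -/
noncomputable def kernel (X : StrongMarkovProcess M Ω) (t : ℝ≥0) : Kernel M M where
  toFun x := ((X.P (Sum.inl x)).map (X.X t)).comap Sum.inl
  measurable' := by
    refine Measure.measurable_of_measurable_coe _ fun B hB => ?_
    simp_rw [X.transition_apply t _ hB]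
    exact (X.measurable_prob t _ (measurableSet_inl_image.2 hB)).comp measurable_inl

lemma kernel_univ_le (X : StrongMarkovProcess M Ω) (t : ℝ≥0) (x : M) :
    X.kernel t x univ ≤ 1 := by
  have := X.isProbabilityMeasure (Sum.inl x)
  exact (X.transition_apply t x MeasurableSet.univ).trans_le prob_le_one

instance (X : StrongMarkovProcess M Ω) (t : ℝ≥0) : IsFiniteKernel (X.kernel t) :=
  ⟨1, ENNReal.one_lt_top, X.kernel_univ_le t⟩

/-- The transition semigroup on functions, `T_t f(x) = E_x [f(X_t)]`, where `f(∂) = 0`. -/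
noncomputable def transition (X : StrongMarkovProcess M Ω) (t : ℝ≥0) (f : M → ℝ) (x : M) : ℝ :=
  ∫ y, f y ∂X.kernel t x

/-- `X` is `μ`-symmetric: `∫ (T_t f) g dμ = ∫ f (T_t g) dμ` for all nonnegative Borel `f`, `g`. -/
def IsSymmetric (X : StrongMarkovProcess M Ω) (μ : Measure M) : Prop :=
  ∀ (t : ℝ≥0) (f g : M → ℝ≥0∞), Measurable f → Measurable g →
    ∫⁻ x, (∫⁻ y, f y ∂X.kernel t x) * g x ∂μ = ∫⁻ x, f x * (∫⁻ y, g y ∂X.kernel t x) ∂μ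

variable {X : StrongMarkovProcess M Ω} {μ : Measure M}

lemma IsSymmetric.lintegral_le (hX : X.IsSymmetric μ) (t : ℝ≥0) {f : M → ℝ≥0∞}
    (hf : Measurable f) : ∫⁻ x, (∫⁻ y, f y ∂X.kernel t x) ∂μ ≤ ∫⁻ x, f x ∂μ := by
  have h := hX t f 1 hf measurable_one
  simp only [Pi.one_apply, mul_one, lintegral_const, one_mul] at h
  rw [h]
  refine lintegral_mono fun x => ?_
  calc f x * X.kernel t x univ ≤ f x * 1 := by gcongr; exact X.kernel_univ_le t x
    _ = f x := mul_one _

/-- `T_t f` does not depend, up to `μ`-null sets, on the representative of `f`. -/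
lemma IsSymmetric.transition_congr (hX : X.IsSymmetric μ) (t : ℝ≥0) {f g : M → ℝ}
    (h : f =ᵐ[μ] g) : X.transition t f =ᵐ[μ] X.transition t g := by
  obtain ⟨N, hN, hNm, hN0⟩ := exists_measurable_superset_of_null (ae_iff.1 h)
  have h1 := hX.lintegral_le t (measurable_one.indicator hNm : Measurable (N.indicator 1))
  rw [lintegral_indicator_one hNm, hN0, nonpos_iff_eq_zero] at h1
  simp_rw [lintegral_indicator_one hNm] at h1
  rw [lintegral_eq_zero_iff ((X.kernel t).measurable_coe hNm)] at h1
  filter_upwards [h1] with x hx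
  refine integral_congr_ae (ae_iff.2 (measure_mono_null hN hx))

/-- `T_t` maps `L²(M; μ)` to itself if `X` is `μ`-symmetric. -/
lemma IsSymmetric.memLp_transition (hX : X.IsSymmetric μ) (t : ℝ≥0) {f : M → ℝ}
    (hf : MemLp f 2 μ) : MemLp (X.transition t f) 2 μ := by
  obtain ⟨g, hg, hfg⟩ := hf.1
  refine (memLp_congr_ae (hX.transition_congr t hfg)).2 ?_
  have hg2 : MemLp g 2 μ := (memLp_congr_ae hfg).1 hf
  refine ⟨(hg.integral_kernel (κ := X.kernel t)).aestronglyMeasurable, ?_⟩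
  rw [eLpNorm_lt_top_iff_lintegral_rpow_enorm_lt_top (by norm_num) (by norm_num)]
  have hfin := (eLpNorm_lt_top_iff_lintegral_rpow_enorm_lt_top (p := 2) (by norm_num)
    (by norm_num)).1 hg2.2
  refine lt_of_le_of_lt (le_trans (lintegral_mono fun x => ?_)
    (hX.lintegral_le t (f := fun y => ‖g y‖ₑ ^ (2 : ℝ≥0∞).toReal) (by
      have := hg.measurable
      fun_prop))) hfin
  have h1 : ‖X.transition t g x‖ₑ ≤ ∫⁻ y, ‖g y‖ₑ ∂X.kernel t x := enorm_integral_le_lintegral_enorm _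
  have h2 := ENNReal.lintegral_mul_le_Lp_mul_Lq (X.kernel t x) Real.HolderConjugate.two_two
    (f := fun y => ‖g y‖ₑ) (g := 1) hg.measurable.enorm.aemeasurable aemeasurable_one
  simp only [Pi.mul_apply, Pi.one_apply, mul_one, ENNReal.one_rpow, lintegral_const, one_mul] at h2
  have h3 : (X.kernel t x univ) ^ (1 / 2 : ℝ) ≤ 1 :=
    ENNReal.rpow_le_one (X.kernel_univ_le t x) (by norm_num)
  have h4 := h1.trans (h2.trans (mul_le_of_le_one_right' h3))
  calc ‖X.transition t g x‖ₑ ^ (2 : ℝ≥0∞).toReal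
      ≤ ((∫⁻ y, ‖g y‖ₑ ^ (2 : ℝ) ∂X.kernel t x) ^ (1 / 2 : ℝ)) ^ (2 : ℝ) := by
        simp only [ENNReal.toReal_ofNat]
        exact ENNReal.rpow_le_rpow h4 (by norm_num)
    _ = ∫⁻ y, ‖g y‖ₑ ^ (2 : ℝ≥0∞).toReal ∂X.kernel t x := by
        rw [← ENNReal.rpow_mul]; norm_num

/-- The transition semigroup `T_t` on `L²(M; μ)` of a `μ`-symmetric process. -/
noncomputable def T (hX : X.IsSymmetric μ) (t : ℝ≥0) (f : Lp ℝ 2 μ) : Lp ℝ 2 μ :=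
  (hX.memLp_transition t (Lp.memLp f)).toLp (X.transition t f)

/-- Strong continuity of the transition semigroup on `L²(M; μ)`. -/
def IsStronglyContinuous (hX : X.IsSymmetric μ) : Prop :=
  ∀ f : Lp ℝ 2 μ, Tendsto (fun t => T hX t f) (𝓝[>] 0) (𝓝 f)

/-- `HasGenerator hX g h` means that `g ∈ D(L)` and `L g = h`, for the infinitesimal generator
`(L, D(L))` of the transition semigroup on `L²(M; μ)`. -/
def HasGenerator (hX : X.IsSymmetric μ) (g h : Lp ℝ 2 μ) : Prop :=
  Tendsto (fun t : ℝ≥0 => (t : ℝ)⁻¹ • (T hX t g - g)) (𝓝[>] 0) (𝓝 h)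

end StrongMarkovProcess

/-- `S` is a driftless subordinator on the probability space `(Ω, Pr)` with Lévy measure `ν`: a
non-decreasing real-valued Lévy process started at `0`, with
`E exp(-l S_t) = exp(-t φ(l))`, `φ(l) = ∫_{(0,∞)} (1 - exp(-l s)) ν(ds)`.
Only the restriction of `ν` to `(0,∞)` matters. -/
structure IsDriftlessSubordinator {Ω : Type*} [MeasurableSpace Ω] (S : ℝ≥0 → Ω → ℝ)
    (ν : Measure ℝ) (Pr : Measure Ω) : Prop where
  levy : ∫⁻ s in Ioi (0 : ℝ), ENNReal.ofReal (min 1 s) ∂ν < ∞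
  measurable : ∀ t, Measurable (S t)
  zero : ∀ᵐ ω ∂Pr, S 0 ω = 0
  mono : ∀ᵐ ω ∂Pr, Monotone fun t => S t ω
  right_cont : ∀ᵐ ω ∂Pr, ∀ t, ContinuousWithinAt (fun r => S r ω) (Ici t) t
  indep_increments : HasIndepIncrements S Pr
  stationary : ∀ s t, IdentDistrib (fun ω => S (s + t) ω - S s ω) (S t) Pr Pr
  laplace : ∀ (t : ℝ≥0) (l : ℝ), 0 < l →
    ∫ ω, Real.exp (-(l * S t ω)) ∂Pr
      = Real.exp (-(t * ∫ s in Ioi (0 : ℝ), (1 - Real.exp (-(l * s))) ∂ν))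

/-- The inverse subordinator `E_t = inf {s > 0 : S_s > t}`. -/
noncomputable def inverseSubordinator {Ω : Type*} (S : ℝ≥0 → Ω → ℝ) (t : ℝ) (ω : Ω) : ℝ≥0 :=
  sInf {s : ℝ≥0 | 0 < s ∧ t < S s ω}

/-- The tail `w(s) = ν(s, ∞)` of the Lévy measure. -/
noncomputable def levyTail (ν : Measure ℝ) (s : ℝ) : ℝ := ν.real (Ioi s)

namespace StrongMarkovProcess

variable {M Ω : Type*} [MeasurableSpace M] [MeasurableSpace Ω]
  {X : StrongMarkovProcess M Ω} {μ : Measure M}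

/-- `u(t) = E [T_{E_t} f]`, the expectation being a Bochner integral in `L²(M; μ)`. -/
noncomputable def subordinate {Ω' : Type*} [MeasurableSpace Ω'] (hX : X.IsSymmetric μ)
    (S : ℝ≥0 → Ω' → ℝ) (Pr : Measure Ω') (f : Lp ℝ 2 μ) (t : ℝ) : Lp ℝ 2 μ :=
  ∫ ω, T hX (inverseSubordinator S t ω) f ∂Pr

/-- `I_t^w u = ∫_0^t w(t - s) (u(s) - f) ds`, a Bochner integral in `L²(M; μ)`. -/
noncomputable def fracIntegral (w : ℝ → ℝ) (f : Lp ℝ 2 μ) (u : ℝ → Lp ℝ 2 μ) (t : ℝ) : Lp ℝ 2 μ :=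
  ∫ s in Ioc 0 t, w (t - s) • (u s - f)

/-- `u : [0,∞) → L²(M; μ)` is a weak solution of `∂_t^w u = L u`, `u(0) = f`. -/
structure IsWeakSolution (hX : X.IsSymmetric μ) (w : ℝ → ℝ) (f : Lp ℝ 2 μ)
    (u : ℝ → Lp ℝ 2 μ) : Prop where
  initial : u 0 = f
  continuousOn : ContinuousOn u (Ici 0)
  hasDerivAt : ∀ g Lg : Lp ℝ 2 μ, HasGenerator hX g Lg → ∀ t : ℝ, 0 < t →
    HasDerivAt (fun r => ∫ x, g x * fracIntegral w f u r x ∂μ) (∫ x, u t x * Lg x ∂μ) t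

end StrongMarkovProcess

/-!
After modifying `S` on a null set, every path is strictly increasing, right-continuous and
unbounded, so its inverse `E` is continuous. Everything comes from the renewal identity `w * V = 1`
between the tail of the Lévy measure and the potential measure `V = E ∫ 1{S_a ∈ ·} da`, verified on
Laplace transforms; its pathwise form gives `w * E [∫_0^{E_t} T_a x da] = 1 * E [T_{E_t} x]`.

Since `L ∫_0^r T_a x da = T_r x - x`, the element `z = E [∫_0^{E} T_a x da]` lies in `D(L)` with
`L z = U x - x`, where `U x = E [T_E x]`. With `x = L g` this gives `w * (U g - g) = 1 * U (L g)`,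
so `U f` is a weak solution by symmetry. If `v` is the difference of two weak solutions, then
`⟪g, w * v⟫ = ⟪1 * v, L g⟫` for `g ∈ D(L)`, and testing against `g = z(t - s)` yields
`1 * ⟪1 * v, x⟫ = 0` for every `x`, hence `v = 0`.
-/

theorem measure_eq_of_mgf_eventuallyEq {m₁ m₂ : Measure ℝ} [IsFiniteMeasure m₁] [IsFiniteMeasure m₂]
    (h₁ : 0 ∈ interior (integrableExpSet id m₁)) (h₂ : 0 ∈ interior (integrableExpSet id m₂))
    (h : mgf id m₁ =ᶠ[𝓝 0] mgf id m₂) : m₁ = m₂ := by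
  set I : Set ℝ := interior (integrableExpSet id m₁) ∩ interior (integrableExpSet id m₂)
  have strip : IsPreconnected {z : ℂ | z.re ∈ I} :=
    ((convex_integrableExpSet.interior.inter convex_integrableExpSet.interior).linear_preimage
      Complex.reLm).isPreconnected
  have toComplex : Tendsto ((↑) : ℝ → ℂ) (𝓝[≠] 0) (𝓝[≠] 0) :=
    tendsto_nhdsWithin_of_tendsto_nhds_of_eventually_within _
      (Complex.continuous_ofReal.tendsto' 0 0 rfl |>.mono_left nhdsWithin_le_nhds)
      (eventually_mem_nhdsWithin.mono fun x hx => Complex.ofReal_ne_zero.2 hx)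
  have frequently_eq : ∃ᶠ z in 𝓝[≠] (0 : ℂ), complexMGF id m₁ z = complexMGF id m₂ z := by
    refine toComplex.frequently ((h.filter_mono nhdsWithin_le_nhds).mono fun x hx => ?_).frequently
    rw [complexMGF_ofReal, complexMGF_ofReal, hx]
  have eqOn_strip : EqOn (complexMGF id m₁) (complexMGF id m₂) {z : ℂ | z.re ∈ I} :=
    AnalyticOnNhd.eqOn_of_preconnected_of_frequently_eq
      (analyticOnNhd_complexMGF.mono fun z hz => hz.1)
      (analyticOnNhd_complexMGF.mono fun z hz => hz.2) strip (z₀ := 0) ⟨h₁, h₂⟩ frequently_eq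
  refine Measure.ext_of_charFun (funext fun t => ?_)
  rw [← complexMGF_id_mul_I, ← complexMGF_id_mul_I]
  exact eqOn_strip (by simpa using ⟨h₁, h₂⟩)

/-- The Laplace transform `l ↦ ∫ exp (-l x) m(dx)` of a measure on the line, with values in
`[0, ∞]` so that no integrability has to be tracked. -/
noncomputable def laplaceTransform (m : Measure ℝ) (l : ℝ) : ℝ≥0∞ :=
  ∫⁻ x, ENNReal.ofReal (Real.exp (-(l * x))) ∂m

theorem mem_integrableExpSet_iff_laplaceTransform {m : Measure ℝ} {t : ℝ} :
    t ∈ integrableExpSet id m ↔ laplaceTransform m (-t) < ∞ := by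
  simp only [integrableExpSet, mem_ofPred_eq, Integrable, laplaceTransform,
    hasFiniteIntegral_iff_ofReal (ae_of_all _ fun _ => (Real.exp_pos _).le), neg_mul, neg_neg, id]
  exact and_iff_right (by fun_prop)

theorem mgf_id_eq_laplaceTransform (m : Measure ℝ) (t : ℝ) :
    mgf id m t = (laplaceTransform m (-t)).toReal := by
  simp only [mgf, laplaceTransform, neg_mul, neg_neg, id]
  exact integral_eq_lintegral_of_nonneg_ae (ae_of_all _ fun _ => (Real.exp_pos _).le) (by fun_prop)

theorem laplaceTransform_withDensity_exp (m : Measure ℝ) (l : ℝ) :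
    laplaceTransform (m.withDensity fun x => ENNReal.ofReal (Real.exp (-x))) l
      = laplaceTransform m (l + 1) := by
  rw [laplaceTransform, lintegral_withDensity_eq_lintegral_mul _ (by fun_prop) (by fun_prop)]
  refine lintegral_congr fun x => ?_
  rw [Pi.mul_apply, ← ENNReal.ofReal_mul (Real.exp_pos _).le, ← Real.exp_add]
  ring_nf

theorem measure_eq_of_laplaceTransform_eq {m₁ m₂ : Measure ℝ}
    (hfin : ∀ l > 0, laplaceTransform m₁ l < ∞)
    (h : ∀ l > 0, laplaceTransform m₁ l = laplaceTransform m₂ l) : m₁ = m₂ := by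
  set d : ℝ → ℝ≥0∞ := fun x => ENNReal.ofReal (Real.exp (-x)) with hd
  have hdm : Measurable d := by fun_prop
  have hfin₂ : ∀ l > 0, laplaceTransform m₂ l < ∞ := fun l hl => h l hl ▸ hfin l hl
  have isFinite_tilt : ∀ m : Measure ℝ, (∀ l > 0, laplaceTransform m l < ∞) →
      IsFiniteMeasure (m.withDensity d) := fun m hm =>
    isFiniteMeasure_withDensity (by simpa [laplaceTransform] using (hm 1 one_pos).ne)
  have zero_mem_interior : ∀ m : Measure ℝ, (∀ l > 0, laplaceTransform m l < ∞) →
      0 ∈ interior (integrableExpSet id (m.withDensity d)) := fun m hm =>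
    mem_interior.2 ⟨Iio 1, fun t (ht : t < 1) => mem_integrableExpSet_iff_laplaceTransform.2 <| by
      rw [laplaceTransform_withDensity_exp]
      exact hm _ (by linarith), isOpen_Iio, one_pos (α := ℝ)⟩
  have := isFinite_tilt m₁ hfin
  have := isFinite_tilt m₂ hfin₂
  have tilt_eq : m₁.withDensity d = m₂.withDensity d := by
    refine measure_eq_of_mgf_eventuallyEq (zero_mem_interior m₁ hfin) (zero_mem_interior m₂ hfin₂)
      (eventually_of_mem (Iio_mem_nhds one_pos) fun t (ht : t < 1) => ?_)
    rw [mgf_id_eq_laplaceTransform, mgf_id_eq_laplaceTransform, laplaceTransform_withDensity_exp,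
      laplaceTransform_withDensity_exp, h _ (by linarith)]
  have untilt : ∀ m : Measure ℝ, (m.withDensity d).withDensity d⁻¹ = m := fun m =>
    withDensity_inv_same hdm (ae_of_all _ fun x => by simp [hd, Real.exp_pos])
      (ae_of_all _ fun x => ENNReal.ofReal_ne_top)
  rw [← untilt m₁, tilt_eq, untilt]

theorem measure_Iic_le_exp_mul_laplaceTransform (m : Measure ℝ) {l : ℝ} (hl : 0 ≤ l) (t : ℝ) :
    m (Iic t) ≤ ENNReal.ofReal (Real.exp (l * t)) * laplaceTransform m l := by
  rw [laplaceTransform, ← lintegral_const_mul _ (by fun_prop), ← setLIntegral_one]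
  refine (setLIntegral_mono (by fun_prop) fun x hx => ?_).trans (setLIntegral_le_lintegral _ _)
  rw [← ENNReal.ofReal_mul (Real.exp_pos _).le, ← Real.exp_add, ENNReal.one_le_ofReal,
    Real.one_le_exp_iff, ← sub_eq_add_neg, ← mul_sub]
  exact mul_nonneg hl (sub_nonneg.2 hx)

/-- The measure `m(s, ∞) ds` on `(0, ∞)`. For a Lévy measure its density is the tail `w`; for the
law of a nonnegative random variable it is the integrated tail distribution. -/
noncomputable def tailMeasure (m : Measure ℝ) : Measure ℝ :=
  (volume.restrict (Ioi 0)).withDensity fun s => m (Ioi s)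

theorem measurable_measure_Ioi (m : Measure ℝ) : Measurable fun s => m (Ioi s) :=
  Antitone.measurable fun _ _ h => measure_mono (Ioi_subset_Ioi h)

theorem integral_exp_neg_mul {l : ℝ} (hl : l ≠ 0) (x : ℝ) :
    ∫ t in (0 : ℝ)..x, Real.exp (-(l * t)) = (1 - Real.exp (-(l * x))) / l := by
  have hderiv : ∀ t ∈ uIcc 0 x, HasDerivAt (fun t => -Real.exp (-(l * t)) / l)
      (Real.exp (-(l * t))) t := fun t _ =>
    (((hasDerivAt_id t).const_mul l).neg.exp.neg.div_const l).congr_deriv (by simp [hl])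
  rw [intervalIntegral.integral_eq_sub_of_hasDerivAt hderiv
    (Continuous.intervalIntegrable (by fun_prop) _ _), mul_zero, neg_zero, Real.exp_zero]
  ring

theorem one_sub_exp_neg_mul_nonneg {l s : ℝ} (hl : 0 ≤ l) (hs : 0 ≤ s) :
    0 ≤ 1 - Real.exp (-(l * s)) :=
  sub_nonneg.2 (Real.exp_le_one_iff.2 (neg_nonpos.2 (mul_nonneg hl hs)))

theorem laplaceTransform_tailMeasure (m : Measure ℝ) {l : ℝ} (hl : 0 < l) :
    laplaceTransform (tailMeasure m) l
      = ENNReal.ofReal l⁻¹ * ∫⁻ x in Ioi 0, ENNReal.ofReal (1 - Real.exp (-(l * x))) ∂m := by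
  have layerCake := lintegral_comp_eq_lintegral_meas_lt_mul (m.restrict (Ioi 0)) (f := id)
    (g := fun x => Real.exp (-(l * x)))
    ((ae_restrict_mem measurableSet_Ioi).mono fun s hs => le_of_lt hs) aemeasurable_id
    (fun t _ => Continuous.intervalIntegrable (by fun_prop) _ _)
    (ae_of_all _ fun x => (Real.exp_pos _).le)
  simp only [id, integral_exp_neg_mul hl.ne', div_eq_inv_mul,
    ENNReal.ofReal_mul (inv_nonneg.2 hl.le)] at layerCake
  rw [← lintegral_const_mul _ (by fun_prop), layerCake, laplaceTransform, tailMeasure,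
    lintegral_withDensity_eq_lintegral_mul _ (measurable_measure_Ioi m) (by fun_prop)]
  refine setLIntegral_congr_fun measurableSet_Ioi fun s hs => ?_
  change m (Ioi s) * _ = (m.restrict (Ioi 0)) (Ioi s) * _
  rw [Measure.restrict_apply measurableSet_Ioi,
    inter_eq_left.2 (Ioi_subset_Ioi (le_of_lt hs) : Ioi s ⊆ Ioi 0)]

/-- `ν` is the Lévy measure of a subordinator; only its restriction to `(0, ∞)` matters. -/
def IsLevyMeasure (ν : Measure ℝ) : Prop :=
  ∫⁻ s in Ioi (0 : ℝ), ENNReal.ofReal (min 1 s) ∂ν < ∞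

/-- The Laplace exponent of the driftless subordinator with Lévy measure `ν`. -/
noncomputable def laplaceExponent (ν : Measure ℝ) (l : ℝ) : ℝ :=
  ∫ s in Ioi (0 : ℝ), (1 - Real.exp (-(l * s))) ∂ν

section LevyMeasure

variable {ν : Measure ℝ}

theorem levyTail_nonneg (s : ℝ) : 0 ≤ levyTail ν s := ENNReal.toReal_nonneg

theorem measurable_levyTail : Measurable (levyTail ν) := (measurable_measure_Ioi ν).ennreal_toReal

theorem IsLevyMeasure.measure_Ioi_lt_top (h : IsLevyMeasure ν) {x : ℝ} (hx : 0 < x) :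
    ν (Ioi x) < ∞ := by
  have markov := meas_ge_le_lintegral_div (μ := ν.restrict (Ioi 0))
    (f := fun s => ENNReal.ofReal (min 1 s)) (by fun_prop) (ε := ENNReal.ofReal (min 1 x))
    (by simp [hx]) ENNReal.ofReal_ne_top
  refine lt_of_le_of_lt ?_ (markov.trans_lt (ENNReal.div_lt_top h.ne (by simp [hx])))
  rw [Measure.restrict_apply (measurableSet_le (by fun_prop) (by fun_prop))]
  exact measure_mono fun s hs =>
    ⟨ENNReal.ofReal_le_ofReal (min_le_min le_rfl (le_of_lt hs)), hx.trans hs⟩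

theorem IsLevyMeasure.ofReal_levyTail (h : IsLevyMeasure ν) {x : ℝ} (hx : 0 < x) :
    ENNReal.ofReal (levyTail ν x) = ν (Ioi x) :=
  ENNReal.ofReal_toReal (h.measure_Ioi_lt_top hx).ne

theorem IsLevyMeasure.integrableOn_one_sub_exp (h : IsLevyMeasure ν) {l : ℝ} (hl : 0 < l) :
    IntegrableOn (fun s => 1 - Real.exp (-(l * s))) (Ioi 0) ν := by
  have hmin : IntegrableOn (fun s => min 1 s) (Ioi 0) ν := by
    refine ⟨by fun_prop, (hasFiniteIntegral_iff_ofReal ?_).2 h⟩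
    filter_upwards [ae_restrict_mem measurableSet_Ioi] with s hs using le_min zero_le_one hs.le
  refine (hmin.const_mul (max 1 l)).mono' (by fun_prop) ?_
  filter_upwards [ae_restrict_mem measurableSet_Ioi] with s (hs : 0 < s)
  rw [Real.norm_of_nonneg (one_sub_exp_neg_mul_nonneg hl.le hs.le)]
  have := Real.add_one_le_exp (-(l * s))
  have := Real.exp_pos (-(l * s))
  have := le_max_left 1 l
  have := le_max_right 1 l
  rcases le_total 1 s with h1s | hs1
  · rw [min_eq_left h1s]; linarith
  · rw [min_eq_right hs1]; nlinarith

theorem IsLevyMeasure.ofReal_laplaceExponent (h : IsLevyMeasure ν) {l : ℝ} (hl : 0 < l) :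
    ENNReal.ofReal (laplaceExponent ν l)
      = ∫⁻ s in Ioi (0 : ℝ), ENNReal.ofReal (1 - Real.exp (-(l * s))) ∂ν :=
  ofReal_integral_eq_lintegral_ofReal (h.integrableOn_one_sub_exp hl) <|
    (ae_restrict_mem measurableSet_Ioi).mono fun _ hs =>
      one_sub_exp_neg_mul_nonneg hl.le (le_of_lt hs)

theorem IsLevyMeasure.laplaceExponent_pos (h : IsLevyMeasure ν) (hν : ν (Ioi 0) ≠ 0) {l : ℝ}
    (hl : 0 < l) : 0 < laplaceExponent ν l := by
  rw [← ENNReal.ofReal_pos, h.ofReal_laplaceExponent hl,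
    setLIntegral_pos_iff (by fun_prop), pos_iff_ne_zero]
  have hsub : Ioi 0 ⊆
      (Function.support fun s => ENNReal.ofReal (1 - Real.exp (-(l * s)))) ∩ Ioi 0 :=
    fun s hs => ⟨by simpa [Function.mem_support] using mul_pos hl hs, hs⟩
  exact fun h0 => hν (measure_mono_null hsub h0)

theorem IsLevyMeasure.tendsto_laplaceExponent (h : IsLevyMeasure ν) (hν : ν (Ioi 0) = ∞) :
    Tendsto (fun n : ℕ => laplaceExponent ν (n + 1)) atTop atTop := by
  have htop : ∫⁻ _ in Ioi (0 : ℝ), ENNReal.ofReal 1 ∂ν = ∞ := by simp [hν]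
  rw [← ENNReal.tendsto_ofReal_nhds_top, ← htop]
  simp_rw [fun n : ℕ => h.ofReal_laplaceExponent (by positivity : (0 : ℝ) < n + 1)]
  refine lintegral_tendsto_of_tendsto_of_monotone (fun n => by fun_prop) ?_ ?_
  all_goals filter_upwards [ae_restrict_mem measurableSet_Ioi] with s (hs : 0 < s)
  · intro n m hnm
    dsimp only
    gcongr
  · have hlim : Tendsto (fun n : ℕ => (n + 1 : ℝ) * s) atTop atTop :=
      (tendsto_atTop_add_const_right _ 1 tendsto_natCast_atTop_atTop).atTop_mul_const hs
    refine ENNReal.tendsto_ofReal ?_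
    simpa using (Real.tendsto_exp_neg_atTop_nhds_zero.comp hlim).const_sub 1

theorem IsLevyMeasure.laplaceTransform_tailMeasure (h : IsLevyMeasure ν) {l : ℝ} (hl : 0 < l) :
    laplaceTransform (tailMeasure ν) l = ENNReal.ofReal (l⁻¹ * laplaceExponent ν l) := by
  rw [_root_.laplaceTransform_tailMeasure ν hl, ← h.ofReal_laplaceExponent hl,
    ENNReal.ofReal_mul (inv_nonneg.2 hl.le)]

theorem IsLevyMeasure.tailMeasure_eq (h : IsLevyMeasure ν) :
    tailMeasure ν
      = (volume.restrict (Ioi 0)).withDensity fun s => ENNReal.ofReal (levyTail ν s) :=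
  withDensity_congr_ae <| (ae_restrict_mem measurableSet_Ioi).mono fun _ hs =>
    (h.ofReal_levyTail hs).symm

theorem IsLevyMeasure.integrableOn_levyTail (h : IsLevyMeasure ν) (t : ℝ) :
    IntegrableOn (levyTail ν) (Ioc 0 t) := by
  refine ⟨measurable_levyTail.aestronglyMeasurable, ?_⟩
  rw [hasFiniteIntegral_iff_ofReal (ae_of_all _ levyTail_nonneg), ← Ioi_inter_Iic, inter_comm,
    ← Measure.restrict_restrict measurableSet_Iic, ← withDensity_apply _ measurableSet_Iic,
    ← h.tailMeasure_eq]
  refine (measure_Iic_le_exp_mul_laplaceTransform _ zero_le_one t).trans_lt ?_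
  rw [h.laplaceTransform_tailMeasure one_pos]
  exact ENNReal.mul_lt_top ENNReal.ofReal_lt_top ENNReal.ofReal_lt_top

end LevyMeasure

/-- Strictly increasing, right-continuous, unbounded paths issued from `0`: almost every path of a
driftless subordinator with infinite Lévy measure. -/
structure IsRegularPath (x : ℝ≥0 → ℝ) : Prop where
  zero : x 0 = 0
  strictMono : StrictMono x
  right_cont : ∀ t, ContinuousWithinAt x (Ici t) t
  tendsto : Tendsto x atTop atTop

theorem isRegularPath_coe : IsRegularPath ((↑) : ℝ≥0 → ℝ) where
  zero := rfl
  strictMono := fun _ _ h => h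
  right_cont := fun _ => NNReal.continuous_coe.continuousWithinAt
  tendsto := NNReal.tendsto_coe_atTop.2 tendsto_id

theorem IsRegularPath.nonneg {x : ℝ≥0 → ℝ} (h : IsRegularPath x) (a : ℝ≥0) : 0 ≤ x a :=
  h.zero ▸ h.strictMono.monotone (zero_le (a := a))

/-- A driftless subordinator with infinite Lévy measure all of whose paths are regular. Only the
one-dimensional marginals matter in the sequel, hence independence of increments is dropped. -/
structure IsRegularSubordinator {Ω : Type*} [MeasurableSpace Ω] (σ : ℝ≥0 → Ω → ℝ) (ν : Measure ℝ)
    (Pr : Measure Ω) : Prop where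
  levy : IsLevyMeasure ν
  infinite : ν (Ioi 0) = ∞
  measurable : ∀ a, Measurable (σ a)
  path : ∀ ω, IsRegularPath fun a => σ a ω
  laplace : ∀ (a : ℝ≥0) (l : ℝ), 0 < l →
    laplaceTransform (Pr.map (σ a)) l = ENNReal.ofReal (Real.exp (-(a * laplaceExponent ν l)))

namespace IsDriftlessSubordinator

variable {Ω : Type*} [MeasurableSpace Ω] {S : ℝ≥0 → Ω → ℝ} {ν : Measure ℝ} {Pr : Measure Ω}

theorem ae_nonneg (hS : IsDriftlessSubordinator S ν Pr) : ∀ᵐ ω ∂Pr, ∀ t, 0 ≤ S t ω := by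
  filter_upwards [hS.zero, hS.mono] with ω h0 hmono t
  exact h0 ▸ hmono (zero_le (a := t))

variable [IsProbabilityMeasure Pr]

theorem laplaceTransform_map (hS : IsDriftlessSubordinator S ν Pr) (t : ℝ≥0) {l : ℝ}
    (hl : 0 < l) : laplaceTransform (Pr.map (S t)) l
      = ENNReal.ofReal (Real.exp (-(t * laplaceExponent ν l))) := by
  have hmeas := hS.measurable t
  have hint : Integrable (fun ω => Real.exp (-(l * S t ω))) Pr := by
    refine (integrable_const (1 : ℝ)).mono' (by fun_prop) ?_
    filter_upwards [hS.ae_nonneg] with ω h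
    rw [Real.norm_of_nonneg (Real.exp_pos _).le, Real.exp_le_one_iff, neg_nonpos]
    exact mul_nonneg hl.le (h t)
  rw [laplaceTransform, lintegral_map (by fun_prop) hmeas, laplaceExponent, ← hS.laplace t l hl,
    ofReal_integral_eq_lintegral_ofReal hint (ae_of_all _ fun _ => (Real.exp_pos _).le)]

theorem measure_setOf_le_le (hS : IsDriftlessSubordinator S ν Pr) (t : ℝ≥0) {l : ℝ} (hl : 0 < l)
    (K : ℝ) : Pr {ω | S t ω ≤ K} ≤ ENNReal.ofReal (Real.exp (l * K))
      * ENNReal.ofReal (Real.exp (-(t * laplaceExponent ν l))) := by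
  rw [← hS.laplaceTransform_map t hl]
  exact (Measure.map_apply (hS.measurable t) measurableSet_Iic).symm.trans_le
    (measure_Iic_le_exp_mul_laplaceTransform _ hl.le K)

theorem measure_nonpos_eq_zero (hS : IsDriftlessSubordinator S ν Pr) (hν : ν (Ioi 0) = ∞)
    {t : ℝ≥0} (ht : 0 < t) : Pr {ω | S t ω ≤ 0} = 0 := by
  have hlim : Tendsto (fun n : ℕ => ENNReal.ofReal (Real.exp (-(t * laplaceExponent ν (n + 1)))))
      atTop (𝓝 0) := by
    rw [← ENNReal.ofReal_zero]
    exact ENNReal.tendsto_ofReal (Real.tendsto_exp_neg_atTop_nhds_zero.comp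
      ((IsLevyMeasure.tendsto_laplaceExponent hS.levy hν).const_mul_atTop (NNReal.coe_pos.2 ht)))
  refine nonpos_iff_eq_zero.1 (ge_of_tendsto' hlim fun n => ?_)
  simpa using hS.measure_setOf_le_le t (l := n + 1) (by positivity) 0

theorem ae_strictMono (hS : IsDriftlessSubordinator S ν Pr) (hν : ν (Ioi 0) = ∞) :
    ∀ᵐ ω ∂Pr, StrictMono fun t => S t ω := by
  obtain ⟨D, hDc, hD⟩ := TopologicalSpace.exists_countable_dense ℝ≥0
  have ae_lt : ∀ p q, p < q → ∀ᵐ ω ∂Pr, S p ω < S q ω := fun p q hpq => by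
    have heq := (hS.stationary p (q - p)).measure_mem_eq (s := Iic 0) measurableSet_Iic
    rw [add_tsub_cancel_of_le hpq.le] at heq
    have hpre : {ω | ¬S p ω < S q ω} = (fun ω => S q ω - S p ω) ⁻¹' Iic 0 := by ext ω; simp
    rw [ae_iff, hpre, heq]
    exact hS.measure_nonpos_eq_zero hν (tsub_pos_of_lt hpq)
  have ae_lt_on : ∀ᵐ ω ∂Pr, ∀ p ∈ D, ∀ q ∈ D, p < q → S p ω < S q ω :=
    (ae_ball_iff hDc).2 fun p _ => (ae_ball_iff hDc).2 fun q _ =>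
      ae_all_iff.2 (ae_lt p q)
  filter_upwards [ae_lt_on, hS.mono] with ω hlt hmono s t hst
  obtain ⟨p, hp, hsp, hpt⟩ := hD.exists_between hst
  obtain ⟨q, hq, hpq, hqt⟩ := hD.exists_between hpt
  exact (hmono hsp.le).trans_lt ((hlt p hp q hq hpq).trans_le (hmono hqt.le))

theorem ae_tendsto (hS : IsDriftlessSubordinator S ν Pr) (hν : ν (Ioi 0) = ∞) :
    ∀ᵐ ω ∂Pr, Tendsto (fun t => S t ω) atTop atTop := by
  have ae_exists_gt : ∀ K : ℕ, ∀ᵐ ω ∂Pr, ∃ n : ℕ, (K : ℝ) < S n ω := fun K => by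
    have hpos := IsLevyMeasure.laplaceExponent_pos hS.levy (by simp [hν]) one_pos
    have hlim : Tendsto (fun n : ℕ => ENNReal.ofReal (Real.exp (1 * K))
        * ENNReal.ofReal (Real.exp (-(n * laplaceExponent ν 1)))) atTop (𝓝 0) := by
      rw [← mul_zero (ENNReal.ofReal (Real.exp (1 * K))), ← ENNReal.ofReal_zero]
      exact ENNReal.Tendsto.const_mul (ENNReal.tendsto_ofReal
        (Real.tendsto_exp_neg_atTop_nhds_zero.comp
          (tendsto_natCast_atTop_atTop.atTop_mul_const hpos))) (Or.inr ENNReal.ofReal_ne_top)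
    refine ae_iff.2 (nonpos_iff_eq_zero.1 (ge_of_tendsto' hlim fun n => ?_))
    refine (measure_mono fun ω hω => ?_).trans (hS.measure_setOf_le_le n one_pos K)
    exact not_lt.1 (not_exists.1 hω n)
  filter_upwards [ae_all_iff.2 ae_exists_gt, hS.mono] with ω hgt hmono
  refine tendsto_atTop_atTop_of_monotone hmono fun b => ?_
  obtain ⟨K, hK⟩ := exists_nat_ge b
  obtain ⟨n, hn⟩ := hgt K
  exact ⟨n, hK.trans hn.le⟩

theorem exists_regular_modification (hS : IsDriftlessSubordinator S ν Pr) (hν : ν (Ioi 0) = ∞) :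
    ∃ σ : ℝ≥0 → Ω → ℝ, IsRegularSubordinator σ ν Pr ∧ ∀ᵐ ω ∂Pr, ∀ t, σ t ω = S t ω := by
  classical
  have ae_regular : ∀ᵐ ω ∂Pr, IsRegularPath fun t => S t ω := by
    filter_upwards [hS.zero, hS.ae_strictMono hν, hS.right_cont, hS.ae_tendsto hν]
      with ω hzero hmono hcont hlim using ⟨hzero, hmono, hcont, hlim⟩
  obtain ⟨N, hN, hNm, hN0⟩ := exists_measurable_superset_of_null (ae_iff.1 ae_regular)
  let σ : ℝ≥0 → Ω → ℝ := fun t ω => if ω ∈ N then (t : ℝ) else S t ω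
  have hσ : ∀ᵐ ω ∂Pr, ∀ t, σ t ω = S t ω := by
    filter_upwards [measure_eq_zero_iff_ae_notMem.1 hN0] with ω h t
    simp only [σ, h, if_false]
  refine ⟨σ, ⟨hS.levy, hν, fun t => .ite hNm measurable_const (hS.measurable t), fun ω => ?_,
    fun t l hl => ?_⟩, hσ⟩
  · by_cases h : ω ∈ N
    · simpa only [σ, h, if_true] using isRegularPath_coe
    · simpa only [σ, h, if_false] using not_not.1 (notMem_subset hN h)
  · rw [Measure.map_congr (hσ.mono fun ω h => h t), hS.laplaceTransform_map t hl]

end IsDriftlessSubordinator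

namespace IsRegularPath

variable {Ω : Type*} {S : ℝ≥0 → Ω → ℝ} {ω : Ω}

theorem lt_inverse_iff (h : IsRegularPath fun t => S t ω) {a : ℝ≥0} {t : ℝ} :
    a < inverseSubordinator S t ω ↔ S a ω < t := by
  constructor
  · intro hat
    obtain ⟨r, har, hr⟩ := exists_between hat
    have hr_notMem := notMem_of_lt_csInf hr (OrderBot.bddBelow _)
    exact (h.strictMono har).trans_le
      (not_lt.1 fun htr => hr_notMem ⟨(zero_le (a := a)).trans_lt har, htr⟩)
  · intro hat
    have hright : ∀ᶠ r in 𝓝[>] a, S r ω < t :=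
      ((h.right_cont a).mono Ioi_subset_Ici_self).eventually_lt_const hat
    obtain ⟨r, hr, har⟩ := (hright.and self_mem_nhdsWithin).exists
    refine lt_of_lt_of_le har (le_csInf ?_ fun s hs => ?_)
    · obtain ⟨s, hs⟩ := ((eventually_gt_atTop 0).and (h.tendsto.eventually_gt_atTop t)).exists
      exact ⟨s, hs⟩
    · exact (h.strictMono.lt_iff_lt.1 (hr.trans hs.2)).le

theorem inverse_le_iff (h : IsRegularPath fun t => S t ω) {a : ℝ≥0} {t : ℝ} :
    inverseSubordinator S t ω ≤ a ↔ t ≤ S a ω := by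
  rw [← not_lt, h.lt_inverse_iff, not_lt]

theorem inverse_mono (h : IsRegularPath fun t => S t ω) :
    Monotone fun t => inverseSubordinator S t ω := fun _ _ hst =>
  h.inverse_le_iff.2 (hst.trans (h.inverse_le_iff.1 le_rfl))

theorem inverse_apply_self (h : IsRegularPath fun t => S t ω) (a : ℝ≥0) :
    inverseSubordinator S (S a ω) ω = a :=
  le_antisymm (h.inverse_le_iff.2 le_rfl)
    (h.strictMono.le_iff_le.1 (h.inverse_le_iff.1 (le_refl (inverseSubordinator S (S a ω) ω))))

theorem inverse_of_nonpos (h : IsRegularPath fun t => S t ω) {t : ℝ} (ht : t ≤ 0) :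
    inverseSubordinator S t ω = 0 :=
  nonpos_iff_eq_zero.1 (h.inverse_le_iff.2 (ht.trans (h.nonneg 0)))

theorem continuous_inverse (h : IsRegularPath fun t => S t ω) :
    Continuous fun t => inverseSubordinator S t ω :=
  h.inverse_mono.continuous_of_surjective fun a => ⟨S a ω, h.inverse_apply_self a⟩

end IsRegularPath

namespace IsRegularSubordinator

variable {Ω : Type*} [MeasurableSpace Ω] {σ : ℝ≥0 → Ω → ℝ} {ν : Measure ℝ} {Pr : Measure Ω}

theorem measurable_uncurry_inverse (hσ : IsRegularSubordinator σ ν Pr) :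
    Measurable (Function.uncurry (inverseSubordinator σ)) := by
  refine measurable_uncurry_of_continuous_of_measurable (fun ω => (hσ.path ω).continuous_inverse)
    fun t => measurable_of_Iic fun a => ?_
  simp only [preimage, mem_Iic, (hσ.path _).inverse_le_iff]
  exact measurableSet_le measurable_const (hσ.measurable a)

theorem measurable_inverse (hσ : IsRegularSubordinator σ ν Pr) (t : ℝ) :
    Measurable (inverseSubordinator σ t) :=
  hσ.measurable_uncurry_inverse.of_uncurry_left

theorem measurable_uncurry (hσ : IsRegularSubordinator σ ν Pr) :
    Measurable (Function.uncurry σ) := by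
  refine measurable_of_Iio fun t => ?_
  simp only [preimage, mem_Iio, Function.uncurry, ← (hσ.path _).lt_inverse_iff]
  exact measurableSet_lt measurable_fst ((hσ.measurable_inverse t).comp measurable_snd)

end IsRegularSubordinator

theorem laplaceTransform_conv (m₁ m₂ : Measure ℝ) [SFinite m₂] (l : ℝ) :
    laplaceTransform (m₁ ∗ m₂) l = laplaceTransform m₁ l * laplaceTransform m₂ l := by
  rw [laplaceTransform, Measure.lintegral_conv (by fun_prop), laplaceTransform,
    ← lintegral_mul_const _ (by fun_prop)]
  refine lintegral_congr fun x => ?_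
  rw [laplaceTransform, ← lintegral_const_mul _ (by fun_prop)]
  refine lintegral_congr fun y => ?_
  rw [← ENNReal.ofReal_mul (Real.exp_pos _).le, ← Real.exp_add]
  ring_nf

section Renewal

variable {Ω : Type*} [MeasurableSpace Ω] {σ : ℝ≥0 → Ω → ℝ} {ν : Measure ℝ} {Pr : Measure Ω}

/-- The potential (expected occupation) measure `∫_0^r P(σ_a ∈ ·) da` of `σ` up to time `r`. -/
noncomputable def potentialMeasure (σ : ℝ≥0 → Ω → ℝ) (Pr : Measure Ω) (r : ℝ) : Measure ℝ :=
  ((volume.restrict (Ioc 0 r)).prod Pr).map fun p => σ p.1.toNNReal p.2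

instance [SFinite Pr] (r : ℝ) : SFinite (potentialMeasure σ Pr r) := by
  rw [potentialMeasure]; infer_instance

namespace IsRegularSubordinator

theorem measurable_comp_toNNReal (hσ : IsRegularSubordinator σ ν Pr) :
    Measurable fun p : ℝ × Ω => σ p.1.toNNReal p.2 :=
  hσ.measurable_uncurry.comp (measurable_fst.real_toNNReal.prodMk measurable_snd)

theorem laplaceExponent_pos (hσ : IsRegularSubordinator σ ν Pr) {l : ℝ} (hl : 0 < l) :
    0 < laplaceExponent ν l :=
  hσ.levy.laplaceExponent_pos (by simp [hσ.infinite]) hl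

variable [IsProbabilityMeasure Pr]

theorem laplaceTransform_tailMeasure_map (hσ : IsRegularSubordinator σ ν Pr) (r : ℝ≥0) {l : ℝ}
    (hl : 0 < l) : laplaceTransform (tailMeasure (Pr.map (σ r))) l
      = ENNReal.ofReal (l⁻¹ * (1 - Real.exp (-(r * laplaceExponent ν l)))) := by
  have := Measure.isProbabilityMeasure_map (μ := Pr) (hσ.measurable r).aemeasurable
  have hsupp : ∀ᵐ x ∂Pr.map (σ r), 0 ≤ x :=
    (ae_map_iff (hσ.measurable r).aemeasurable measurableSet_Ici).2
      (ae_of_all _ fun ω => (hσ.path ω).nonneg r)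
  have hrestrict : ∫⁻ x in Ioi 0, ENNReal.ofReal (1 - Real.exp (-(l * x))) ∂Pr.map (σ r)
      = ∫⁻ x, ENNReal.ofReal (1 - Real.exp (-(l * x))) ∂Pr.map (σ r) :=
    setLIntegral_eq_of_support_subset fun x hx => by
      by_contra hx0
      refine hx (ENNReal.ofReal_of_nonpos (sub_nonpos.2 (Real.one_le_exp ?_)))
      nlinarith [show x ≤ 0 from not_lt.1 hx0]
  rw [laplaceTransform_tailMeasure _ hl, hrestrict]
  simp_rw [ENNReal.ofReal_sub 1 (Real.exp_pos _).le, ENNReal.ofReal_one]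
  rw [lintegral_sub (by fun_prop) (by rw [← laplaceTransform, hσ.laplace r l hl]; simp),
    ← laplaceTransform, hσ.laplace r l hl, lintegral_one, measure_univ, ← ENNReal.ofReal_one,
    ← ENNReal.ofReal_sub 1 (Real.exp_pos _).le, ENNReal.ofReal_mul (inv_nonneg.2 hl.le)]
  filter_upwards [hsupp] with x hx
  rw [ENNReal.ofReal_le_one]
  exact sub_nonneg.1 (one_sub_exp_neg_mul_nonneg hl.le hx)

theorem laplaceTransform_potentialMeasure (hσ : IsRegularSubordinator σ ν Pr) (r : ℝ≥0) {l : ℝ}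
    (hl : 0 < l) : laplaceTransform (potentialMeasure σ Pr r) l
      = ENNReal.ofReal ((1 - Real.exp (-(r * laplaceExponent ν l))) / laplaceExponent ν l) := by
  have hmeas := hσ.measurable_comp_toNNReal
  have hexp : Measurable fun p : ℝ × Ω => ENNReal.ofReal (Real.exp (-(l * σ p.1.toNNReal p.2))) :=
    (Real.measurable_exp.comp (hmeas.const_mul l).neg).ennreal_ofReal
  rw [laplaceTransform, potentialMeasure, lintegral_map (by fun_prop) hmeas,
    lintegral_prod _ hexp.aemeasurable]
  have hlaw : ∀ a ∈ Ioc (0 : ℝ) r,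
      ∫⁻ ω, ENNReal.ofReal (Real.exp (-(l * σ a.toNNReal ω))) ∂Pr
        = ENNReal.ofReal (Real.exp (-(laplaceExponent ν l * a))) := fun a ha => by
    rw [← lintegral_map (f := fun x => ENNReal.ofReal (Real.exp (-(l * x)))) (by fun_prop)
      (hσ.measurable _), ← laplaceTransform, hσ.laplace _ l hl, Real.coe_toNNReal _ ha.1.le,
      mul_comm]
  rw [setLIntegral_congr_fun measurableSet_Ioc hlaw, ← ofReal_integral_eq_lintegral_ofReal
    (Continuous.integrableOn_Ioc (by fun_prop)) (ae_of_all _ fun _ => (Real.exp_pos _).le),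
    ← intervalIntegral.integral_of_le r.coe_nonneg,
    integral_exp_neg_mul (hσ.laplaceExponent_pos hl).ne', mul_comm (r : ℝ)]

theorem tailMeasure_map_eq_conv (hσ : IsRegularSubordinator σ ν Pr) (r : ℝ≥0) :
    tailMeasure (Pr.map (σ r)) = tailMeasure ν ∗ potentialMeasure σ Pr r := by
  refine measure_eq_of_laplaceTransform_eq (fun l hl => ?_) fun l hl => ?_
  · rw [hσ.laplaceTransform_tailMeasure_map r hl]
    exact ENNReal.ofReal_lt_top
  · have hpos := hσ.laplaceExponent_pos hl
    rw [hσ.laplaceTransform_tailMeasure_map r hl, laplaceTransform_conv,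
      hσ.laplaceTransform_potentialMeasure r hl, hσ.levy.laplaceTransform_tailMeasure hl,
      ← ENNReal.ofReal_mul (mul_nonneg (inv_nonneg.2 hl.le) hpos.le)]
    field_simp

end IsRegularSubordinator

end Renewal

/-- The kernel sending `r` to Lebesgue measure on `(0, r]`: integrating `k` against it turns a
function into its primitive. -/
noncomputable def lebesgueIoc : Kernel ℝ ℝ where
  toFun r := volume.restrict (Ioc 0 r)
  measurable' := by
    refine Measure.measurable_of_measurable_coe _ fun B hB => ?_
    simp only [Measure.restrict_apply hB]
    exact Monotone.measurable fun r s h =>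
      measure_mono (inter_subset_inter_right _ (Ioc_subset_Ioc_right h))

theorem lebesgueIoc_apply (r : ℝ) : lebesgueIoc r = volume.restrict (Ioc 0 r) := rfl

theorem lebesgueIoc_Iic (r s : ℝ) : lebesgueIoc r (Iic s) = ENNReal.ofReal (min r s) := by
  rw [lebesgueIoc_apply, Measure.restrict_apply measurableSet_Iic, inter_comm, Ioc_inter_Iic,
    Real.volume_Ioc, sub_zero]

section InverseLaw

variable {Ω : Type*} [MeasurableSpace Ω] {σ : ℝ≥0 → Ω → ℝ} {ν : Measure ℝ} {Pr : Measure Ω}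

/-- The mixture `∫ P(E_s ∈ ·) ρ(ds)` of the laws of the inverse of `σ`. -/
noncomputable def inverseLaw (σ : ℝ≥0 → Ω → ℝ) (Pr : Measure Ω) (ρ : Measure ℝ) : Measure ℝ :=
  (ρ.prod Pr).map fun p => (inverseSubordinator σ p.1 p.2 : ℝ)

instance (ρ : Measure ℝ) [IsFiniteMeasure ρ] [IsFiniteMeasure Pr] :
    IsFiniteMeasure (inverseLaw σ Pr ρ) := by
  rw [inverseLaw]; infer_instance

namespace IsRegularSubordinator

theorem measurable_coe_inverse (hσ : IsRegularSubordinator σ ν Pr) :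
    Measurable fun p : ℝ × Ω => (inverseSubordinator σ p.1 p.2 : ℝ) :=
  hσ.measurable_uncurry_inverse.coe_nnreal_real

theorem lintegral_inverseLaw [SFinite Pr] (hσ : IsRegularSubordinator σ ν Pr) (ρ : Measure ℝ)
    {F : ℝ → ℝ≥0∞} (hF : Measurable F) :
    ∫⁻ a, F a ∂inverseLaw σ Pr ρ = ∫⁻ s, ∫⁻ ω, F (inverseSubordinator σ s ω) ∂Pr ∂ρ := by
  rw [inverseLaw, lintegral_map hF hσ.measurable_coe_inverse]
  exact lintegral_prod _ (hF.comp hσ.measurable_coe_inverse).aemeasurable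

theorem integral_inverseLaw [SFinite Pr] {E : Type*} [NormedAddCommGroup E] [NormedSpace ℝ E]
    (hσ : IsRegularSubordinator σ ν Pr) (ρ : Measure ℝ) [SFinite ρ] {F : ℝ → E}
    (hF : Integrable F (inverseLaw σ Pr ρ)) :
    ∫ a, F a ∂inverseLaw σ Pr ρ = ∫ s, ∫ ω, F (inverseSubordinator σ s ω) ∂Pr ∂ρ := by
  have hmeas := hσ.measurable_coe_inverse.aemeasurable (μ := ρ.prod Pr)
  rw [inverseLaw, integral_map hmeas hF.1]
  exact integral_prod _ ((integrable_map_measure hF.1 hmeas).1 hF)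

theorem inverseLaw_Iic_of_neg (hσ : IsRegularSubordinator σ ν Pr) (ρ : Measure ℝ) {r : ℝ}
    (hr : r < 0) : inverseLaw σ Pr ρ (Iic r) = 0 := by
  rw [inverseLaw, Measure.map_apply hσ.measurable_coe_inverse measurableSet_Iic]
  refine (congrArg _ (eq_empty_of_forall_notMem fun p hp => ?_)).trans measure_empty
  exact (hr.trans_le (NNReal.coe_nonneg _)).not_ge hp

theorem inverseLaw_Iic [SFinite Pr] (hσ : IsRegularSubordinator σ ν Pr) (ρ : Measure ℝ) (r : ℝ≥0) :
    inverseLaw σ Pr ρ (Iic (r : ℝ)) = ∫⁻ s, Pr.map (σ r) (Ici s) ∂ρ := by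
  rw [inverseLaw, Measure.map_apply hσ.measurable_coe_inverse measurableSet_Iic,
    Measure.prod_apply (hσ.measurable_coe_inverse measurableSet_Iic)]
  refine lintegral_congr fun s => ?_
  rw [Measure.map_apply (hσ.measurable r) measurableSet_Ici]
  congr 1 with ω
  exact NNReal.coe_le_coe.trans (hσ.path ω).inverse_le_iff

theorem tailMeasure_map_Iio [SFinite Pr] (hσ : IsRegularSubordinator σ ν Pr) (r : ℝ≥0) (t : ℝ) :
    tailMeasure (Pr.map (σ r)) (Iio t)
      = inverseLaw σ Pr (volume.restrict (Ioo 0 t)) (Iic (r : ℝ)) := by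
  rw [hσ.inverseLaw_Iic, tailMeasure, withDensity_apply _ measurableSet_Iio,
    Measure.restrict_restrict measurableSet_Iio, inter_comm, Ioi_inter_Iio]
  exact lintegral_congr_ae (ae_restrict_of_ae (meas_le_ae_eq_meas_lt _ _ id).symm)

theorem potentialMeasure_Iio [SFinite Pr] (hσ : IsRegularSubordinator σ ν Pr) (r : ℝ≥0) (x : ℝ) :
    potentialMeasure σ Pr r (Iio x)
      = ∫⁻ ω, lebesgueIoc (inverseSubordinator σ x ω) (Iic (r : ℝ)) ∂Pr := by
  have hmeas := hσ.measurable_comp_toNNReal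
  rw [potentialMeasure, Measure.map_apply hmeas measurableSet_Iio,
    Measure.prod_apply_symm (hmeas measurableSet_Iio)]
  refine lintegral_congr fun ω => ?_
  rw [← restrict_Ioo_eq_restrict_Ioc, Measure.restrict_apply
    (measurable_prodMk_right (hmeas measurableSet_Iio)), lebesgueIoc_Iic, ← sub_zero (min _ _),
    ← Real.volume_Ioo]
  congr 1 with a
  rw [mem_Ioo, lt_min_iff]
  simp only [mem_inter_iff, mem_preimage, mem_Iio, mem_Ioo, ← (hσ.path ω).lt_inverse_iff]
  constructor
  · rintro ⟨hae, h0, har⟩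
    exact ⟨h0, (Real.toNNReal_lt_iff_lt_coe h0.le).1 hae, har⟩
  · rintro ⟨h0, hae, har⟩
    exact ⟨(Real.toNNReal_lt_iff_lt_coe h0.le).2 hae, h0, har⟩

theorem potentialMeasure_Iio_of_nonpos [SFinite Pr] (hσ : IsRegularSubordinator σ ν Pr) (r : ℝ≥0)
    {x : ℝ} (hx : x ≤ 0) : potentialMeasure σ Pr r (Iio x) = 0 := by
  simp [hσ.potentialMeasure_Iio, (hσ.path _).inverse_of_nonpos hx, lebesgueIoc_apply]

theorem conv_potentialMeasure_Iio [SFinite Pr] (hσ : IsRegularSubordinator σ ν Pr) (r : ℝ≥0)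
    (t : ℝ) : (tailMeasure ν ∗ potentialMeasure σ Pr r) (Iio t)
      = ∫⁻ s in Ioo 0 t, ν (Ioi (t - s)) * potentialMeasure σ Pr r (Iio s) := by
  have htail := measurable_measure_Ioi ν
  have hpot : Measurable fun s => potentialMeasure σ Pr r (Iio s) :=
    Monotone.measurable fun a b h => measure_mono (Iio_subset_Iio h)
  have hconv : (tailMeasure ν ∗ potentialMeasure σ Pr r) (Iio t)
      = ∫⁻ y in Ioi 0, ν (Ioi y) * potentialMeasure σ Pr r (Iio (t - y)) := by
    rw [Measure.conv, Measure.map_apply measurable_add measurableSet_Iio,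
      Measure.prod_apply (measurable_add measurableSet_Iio)]
    simp only [preimage_preimage, preimage_const_add_Iio]
    exact lintegral_withDensity_eq_lintegral_mul _ htail
      (hpot.comp (measurable_const.sub measurable_id))
  rw [hconv, ← lintegral_indicator measurableSet_Ioi, ← lintegral_sub_left_eq_self _ t,
    ← lintegral_indicator measurableSet_Ioo]
  refine lintegral_congr fun s => ?_
  simp only [indicator, mem_Ioi, mem_Ioo, sub_pos, sub_sub_cancel]
  rcases le_or_gt s 0 with hs | hs
  · simp [hσ.potentialMeasure_Iio_of_nonpos r hs]
  · simp only [hs, true_and]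

theorem integrable_inverse (hσ : IsRegularSubordinator σ ν Pr) (t : ℝ) :
    Integrable (fun ω => (inverseSubordinator σ t ω : ℝ)) Pr := by
  have hmeas := (hσ.measurable_inverse t).coe_nnreal_real
  refine ⟨hmeas.aestronglyMeasurable, ?_⟩
  rw [hasFiniteIntegral_iff_ofReal (ae_of_all _ fun ω => NNReal.coe_nonneg _),
    lintegral_eq_lintegral_meas_lt Pr (ae_of_all _ fun ω => NNReal.coe_nonneg _) hmeas.aemeasurable]
  have chernoff : ∀ a ∈ Ioi (0 : ℝ), Pr {ω | a < inverseSubordinator σ t ω}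
      ≤ ENNReal.ofReal (Real.exp (1 * t) * Real.exp (-laplaceExponent ν 1 * a)) := fun a ha => by
    lift a to ℝ≥0 using le_of_lt ha
    rw [neg_mul, mul_comm (laplaceExponent ν 1), ENNReal.ofReal_mul (Real.exp_pos _).le,
      ← hσ.laplace a 1 one_pos]
    refine le_trans ?_ (measure_Iic_le_exp_mul_laplaceTransform _ zero_le_one t)
    rw [Measure.map_apply (hσ.measurable a) measurableSet_Iic]
    exact measure_mono fun ω hω =>
      ((hσ.path ω).lt_inverse_iff.1 (NNReal.coe_lt_coe.1 hω)).le
  have hexp : IntegrableOn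
      (fun a => Real.exp (1 * t) * Real.exp (-laplaceExponent ν 1 * a)) (Ioi 0) :=
    (integrableOn_exp_mul_Ioi (neg_lt_zero.2 (hσ.laplaceExponent_pos one_pos)) 0).const_mul _
  exact (setLIntegral_mono' measurableSet_Ioi chernoff).trans_lt hexp.lintegral_lt_top

variable [IsProbabilityMeasure Pr]

theorem lebesgueIoc_comp_inverseLaw (hσ : IsRegularSubordinator σ ν Pr) (t : ℝ) :
    lebesgueIoc ∘ₘ inverseLaw σ Pr
        ((volume.restrict (Ioo 0 t)).withDensity fun s => ν (Ioi (t - s)))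
      = inverseLaw σ Pr (volume.restrict (Ioo 0 t)) := by
  refine (Measure.ext_of_Iic _ _ fun r => ?_).symm
  rw [Measure.bind_apply measurableSet_Iic lebesgueIoc.measurable.aemeasurable,
    hσ.lintegral_inverseLaw _ (lebesgueIoc.measurable_coe measurableSet_Iic)]
  rcases lt_or_ge r 0 with hr | hr
  · simp [hσ.inverseLaw_Iic_of_neg _ hr, lebesgueIoc_Iic, ENNReal.ofReal_of_nonpos hr.le]
  lift r to ℝ≥0 using hr
  have htail : Measurable fun s => ν (Ioi (t - s)) :=
    (measurable_measure_Ioi ν).comp (measurable_const.sub measurable_id)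
  simp only [← hσ.tailMeasure_map_Iio, hσ.tailMeasure_map_eq_conv, hσ.conv_potentialMeasure_Iio,
    ← hσ.potentialMeasure_Iio]
  rw [lintegral_withDensity_eq_lintegral_mul _ htail]
  · rfl
  · exact (Monotone.measurable fun a b h => measure_mono (Iio_subset_Iio h))

/-- The renewal identity `w * E[∫_0^{E} k] = 1 * E[k(E)]` behind the theorem: it says that
`w(t) dt` convolved with the potential measure of `σ` is Lebesgue measure on `(0, ∞)`. -/
theorem integral_levyTail_smul_integral_inverse {E : Type*} [NormedAddCommGroup E]
    [NormedSpace ℝ E] (hσ : IsRegularSubordinator σ ν Pr) {k : ℝ → E} (hk : StronglyMeasurable k)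
    {C : ℝ} (hC : ∀ a, ‖k a‖ ≤ C) (t : ℝ) :
    ∫ s in Ioc 0 t,
        levyTail ν (t - s) • ∫ ω, (∫ a in Ioc 0 (inverseSubordinator σ s ω : ℝ), k a) ∂Pr
      = ∫ s in Ioc 0 t, ∫ ω, k (inverseSubordinator σ s ω) ∂Pr := by
  have htail : Measurable fun s => ν (Ioi (t - s)) :=
    (measurable_measure_Ioi ν).comp (measurable_const.sub measurable_id)
  have hfin : ∀ᵐ s ∂volume.restrict (Ioo 0 t), ν (Ioi (t - s)) < ∞ :=
    (ae_restrict_mem measurableSet_Ioo).mono fun s hs =>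
      hσ.levy.measure_Ioi_lt_top (sub_pos.2 hs.2)
  have hint : Integrable k (inverseLaw σ Pr (volume.restrict (Ioo 0 t))) :=
    Integrable.of_bound hk.aestronglyMeasurable C (ae_of_all _ hC)
  have hcomp := hσ.lebesgueIoc_comp_inverseLaw t
  rw [integral_Ioc_eq_integral_Ioo, integral_Ioc_eq_integral_Ioo, ← hσ.integral_inverseLaw _ hint,
    ← hcomp]
  rw [← hcomp, Measure.comp_eq_comp_const_apply] at hint
  rw [Measure.comp_eq_comp_const_apply, Kernel.integral_comp hint, Kernel.const_apply,
    hσ.integral_inverseLaw _ hint.integral_comp]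
  exact (integral_withDensity_eq_integral_toReal_smul htail hfin _).symm

end IsRegularSubordinator

end InverseLaw

section CausalConvolution

variable {E F : Type*} [NormedAddCommGroup E] [NormedSpace ℝ E] [NormedAddCommGroup F]
  [NormedSpace ℝ F] {w : ℝ → ℝ} {u v : ℝ → E}

/-- The convolution `(w * u)(t) = ∫_0^t w(t - s) u(s) ds` over the half-line. -/
noncomputable def causalConv (w : ℝ → ℝ) (u : ℝ → E) (t : ℝ) : E :=
  ∫ s in Ioc 0 t, w (t - s) • u s

theorem causalConv_one (u : ℝ → E) (t : ℝ) : causalConv 1 u t = ∫ s in Ioc 0 t, u s := by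
  simp only [causalConv, Pi.one_apply, one_smul]

theorem setIntegral_Ioc_comp_sub_left (u : ℝ → E) (t : ℝ) :
    ∫ s in Ioc 0 t, u (t - s) = ∫ s in Ioc 0 t, u s := by
  rcases le_or_gt 0 t with ht | ht
  · rw [← intervalIntegral.integral_of_le ht, ← intervalIntegral.integral_of_le ht,
      intervalIntegral.integral_comp_sub_left, sub_self, sub_zero]
  · rw [Ioc_eq_empty ht.le.not_gt, setIntegral_empty, setIntegral_empty]

theorem integrableOn_Ioc_comp_sub_left {t : ℝ} (hw : IntegrableOn w (Ioc 0 t)) :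
    IntegrableOn (fun s => w (t - s)) (Ioc 0 t) := by
  rcases le_or_gt 0 t with ht | ht
  · rw [← intervalIntegrable_iff_integrableOn_Ioc_of_le ht] at hw ⊢
    simpa only [sub_zero, sub_self] using (hw.comp_sub_left t).symm
  · simp only [Ioc_eq_empty ht.le.not_gt, integrableOn_empty]

theorem integrableOn_causalConv {t : ℝ} (hw : IntegrableOn w (Ioc 0 t))
    (hu : ContinuousOn u (Ici 0)) : IntegrableOn (fun s => w (t - s) • u s) (Ioc 0 t) :=
  (integrableOn_Ioc_comp_sub_left hw).smul_continuousOn_of_subset (hu.mono Icc_subset_Ici_self)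
    measurableSet_Ioc isCompact_Icc Ioc_subset_Icc_self

theorem causalConv_sub {t : ℝ} (hw : IntegrableOn w (Ioc 0 t)) (hu : ContinuousOn u (Ici 0))
    (hv : ContinuousOn v (Ici 0)) :
    causalConv w (fun s => u s - v s) t = causalConv w u t - causalConv w v t := by
  simp only [causalConv, smul_sub]
  exact integral_sub (integrableOn_causalConv hw hu) (integrableOn_causalConv hw hv)

theorem map_causalConv [CompleteSpace E] [CompleteSpace F] (L : E →L[ℝ] F) {t : ℝ}
    (hw : IntegrableOn w (Ioc 0 t)) (hu : ContinuousOn u (Ici 0)) :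
    L (causalConv w u t) = causalConv w (fun s => L (u s)) t := by
  simp only [causalConv, ← L.integral_comp_comm (integrableOn_causalConv hw hu), map_smul]

theorem integrableOn_one_Ioc (t : ℝ) : IntegrableOn (1 : ℝ → ℝ) (Ioc 0 t) :=
  integrableOn_const measure_Ioc_lt_top.ne

theorem tendsto_causalConv_zero (hw : ∀ t, IntegrableOn w (Ioc 0 t))
    (hu : ContinuousOn u (Ici 0)) : Tendsto (causalConv w u) (𝓝[>] 0) (𝓝 0) := by
  obtain ⟨C, hC⟩ := (isCompact_Icc (a := (0 : ℝ)) (b := 1)).exists_bound_of_continuousOn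
    (hu.mono Icc_subset_Ici_self)
  have hprim : Tendsto (fun t => ∫ s in (0 : ℝ)..t, ‖w s‖) (𝓝[>] 0) (𝓝 0) := by
    have hint : IntegrableOn (fun s => ‖w s‖) (uIcc 0 1) := by
      rw [uIcc_of_le zero_le_one, integrableOn_Icc_iff_integrableOn_Ioc]
      exact (hw 1).norm
    have := (intervalIntegral.continuousOn_primitive_interval hint) 0 left_mem_uIcc
    rw [ContinuousWithinAt, intervalIntegral.integral_same, uIcc_of_le zero_le_one] at this
    exact this.mono_left (nhdsWithin_le_of_mem (Icc_mem_nhdsGT zero_lt_one))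
  refine squeeze_zero_norm' ?_ (by simpa only [zero_mul] using hprim.mul_const C)
  filter_upwards [Ioo_mem_nhdsGT (zero_lt_one (α := ℝ))] with t ht
  rw [intervalIntegral.integral_of_le ht.1.le, ← setIntegral_Ioc_comp_sub_left (fun s => ‖w s‖),
    ← integral_mul_const]
  refine norm_integral_le_of_norm_le
    ((integrableOn_Ioc_comp_sub_left (hw t)).norm.mul_const C) ?_
  filter_upwards [ae_restrict_mem measurableSet_Ioc] with s hs
  rw [norm_smul]
  exact mul_le_mul_of_nonneg_left (hC s ⟨hs.1.le, hs.2.trans ht.2.le⟩) (norm_nonneg _)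

/-- The indicator removes the dependence of the domain of integration on `s`, as needed for
Fubini's theorem. -/
theorem causalConv_eq_setIntegral_indicator (w : ℝ → ℝ) (u : ℝ → E) {s t : ℝ}
    (hst : s ≤ t) : causalConv w u s = ∫ y in Ioc 0 t, (Ioc 0 t).indicator w (s - y) • u y := by
  rw [causalConv, integral_Ioc_eq_integral_Ioo]
  refine Eq.symm ((setIntegral_eq_of_subset_of_forall_sdiff_eq_zero measurableSet_Ioc
    (Ioo_subset_Ioc_self.trans (Ioc_subset_Ioc_right hst)) fun y hy => ?_).trans
      (setIntegral_congr_fun measurableSet_Ioo fun y hy => ?_))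
  · rw [indicator_of_notMem, zero_smul]
    exact fun hmem => hy.2 ⟨hy.1.1, sub_pos.1 hmem.1⟩
  · rw [indicator_of_mem]
    exact ⟨sub_pos.2 hy.2, by linarith [hy.1]⟩

theorem setIntegral_Ioc_eq_intervalIntegral_max (u : ℝ → E) {t : ℝ} (ht : 0 ≤ t) :
    ∫ s in Ioc 0 t, u s = ∫ s in (0 : ℝ)..t, u (max s 0) := by
  rw [intervalIntegral.integral_of_le ht]
  exact setIntegral_congr_fun measurableSet_Ioc fun s hs => by simp only [max_eq_left hs.1.le]

omit [NormedSpace ℝ E] in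
theorem continuous_comp_max_zero (hu : ContinuousOn u (Ici 0)) :
    Continuous fun s => u (max s 0) :=
  hu.comp_continuous (by fun_prop) fun s => le_max_right s 0

theorem continuousOn_causalConv_one (hu : ContinuousOn u (Ici 0)) :
    ContinuousOn (causalConv 1 u) (Ici 0) :=
  (intervalIntegral.continuous_primitive
    (continuous_comp_max_zero hu).intervalIntegrable 0).continuousOn.congr fun t ht => by
      rw [causalConv_one, setIntegral_Ioc_eq_intervalIntegral_max u ht]

theorem hasDerivAt_setIntegral_Ioc [CompleteSpace E] (hu : ContinuousOn u (Ici 0)) {t : ℝ}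
    (ht : 0 < t) : HasDerivAt (fun r => ∫ s in Ioc 0 r, u s) (u t) t := by
  have hderiv := ((continuous_comp_max_zero hu).integral_hasStrictDerivAt 0 t).hasDerivAt
  rw [max_eq_left ht.le] at hderiv
  refine hderiv.congr_of_eventuallyEq ?_
  filter_upwards [Ioi_mem_nhds ht] with r hr
  exact setIntegral_Ioc_eq_intervalIntegral_max u (le_of_lt hr)

theorem eqOn_zero_of_causalConv_one_eqOn_zero [CompleteSpace E] (hu : ContinuousOn u (Ici 0))
    (h : EqOn (causalConv 1 u) 0 (Ici 0)) : EqOn u 0 (Ici 0) := by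
  have hpos : EqOn u 0 (Ioi 0) := fun t (ht : 0 < t) => by
    refine (hasDerivAt_setIntegral_Ioc hu ht).unique
      ((hasDerivAt_const t 0).congr_of_eventuallyEq ?_)
    filter_upwards [Ioi_mem_nhds ht] with r hr
    rw [← causalConv_one, h (mem_Ici_of_Ioi hr), Pi.zero_apply]
  refine hpos.of_subset_closure hu continuousOn_const Ioi_subset_Ici_self ?_
  rw [closure_Ioi]

variable {H : Type*} [NormedAddCommGroup H] [InnerProductSpace ℝ H]

theorem integrableOn_indicator_smul {z : ℝ → E} {t : ℝ} (hw : IntegrableOn w (Ioc 0 t))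
    (hz : ContinuousOn z (Ici 0)) (s : ℝ) :
    IntegrableOn (fun y => (Ioc 0 t).indicator w (s - y) • z y) (Ioc 0 t) :=
  ((hw.integrable_indicator measurableSet_Ioc).comp_sub_left s).integrableOn
    |>.smul_continuousOn_of_subset (hz.mono Icc_subset_Ici_self) measurableSet_Ioc isCompact_Icc
      Ioc_subset_Icc_self

theorem integrable_indicator_mul_inner {v z : ℝ → H} {t : ℝ} (hw : IntegrableOn w (Ioc 0 t))
    (hv : ContinuousOn v (Ici 0)) (hz : ContinuousOn z (Ici 0)) :
    Integrable
      (fun p : ℝ × ℝ => (Ioc 0 t).indicator w (p.1 - p.2) * inner ℝ (v (t - p.1)) (z p.2))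
      ((volume.restrict (Ioc 0 t)).prod (volume.restrict (Ioc 0 t))) := by
  have hkernel : IntegrableOn (fun p : ℝ × ℝ => (Ioc 0 t).indicator w (p.1 - p.2))
      (Ioc 0 t ×ˢ Ioc 0 t) := by
    have h := (Integrable.convolution_integrand (ContinuousLinearMap.mul ℝ ℝ)
      (integrable_const (μ := volume.restrict (Ioc 0 t)) (1 : ℝ))
      (hw.integrable_indicator measurableSet_Ioc)).integrableOn (s := Ioc 0 t ×ˢ univ)
    simpa only [ContinuousLinearMap.mul_apply', one_mul, IntegrableOn, ← Measure.prod_restrict,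
      Measure.restrict_univ, Measure.volume_eq_prod] using h
  have hinner : ContinuousOn (fun p : ℝ × ℝ => inner ℝ (v (t - p.1)) (z p.2))
      (Icc 0 t ×ˢ Icc 0 t) :=
    ContinuousOn.inner (hv.comp (by fun_prop) fun p hp => sub_nonneg.2 hp.1.2)
      (hz.comp continuousOn_snd fun p hp => hp.2.1)
  rw [Measure.prod_restrict, ← Measure.volume_eq_prod]
  exact hkernel.mul_continuousOn_of_subset hinner (measurableSet_Ioc.prod measurableSet_Ioc)
    (isCompact_Icc.prod isCompact_Icc) (prod_mono Ioc_subset_Icc_self Ioc_subset_Icc_self)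

variable [CompleteSpace H]

theorem inner_causalConv (x : H) {y : ℝ → H} {t : ℝ} (hw : IntegrableOn w (Ioc 0 t))
    (hy : ContinuousOn y (Ici 0)) :
    inner ℝ x (causalConv w y t) = causalConv w (fun s => inner ℝ x (y s)) t :=
  map_causalConv (innerSL ℝ x) hw hy

theorem integral_inner_left {α : Type*} [MeasurableSpace α] {m : Measure α} {y : α → H}
    (hy : Integrable y m) (x : H) : ∫ a, inner ℝ (y a) x ∂m = inner ℝ (∫ a, y a ∂m) x := by
  simp only [real_inner_comm x, ← integral_inner hy]

/-- Fubini: both sides are `∫ w(q) ⟪v(p), z(r)⟫` over the simplex `p + q + r = t`. -/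
theorem setIntegral_inner_causalConv {v z : ℝ → H} {t : ℝ} (hw : IntegrableOn w (Ioc 0 t))
    (hv : ContinuousOn v (Ici 0)) (hz : ContinuousOn z (Ici 0)) :
    ∫ s in Ioc 0 t, inner ℝ (v (t - s)) (causalConv w z s)
      = ∫ s in Ioc 0 t, inner ℝ (causalConv w v (t - s)) (z s) := by
  set W := (Ioc 0 t).indicator w
  calc ∫ s in Ioc 0 t, inner ℝ (v (t - s)) (causalConv w z s)
      = ∫ s in Ioc 0 t, ∫ y in Ioc 0 t, W (s - y) * inner ℝ (v (t - s)) (z y) :=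
        setIntegral_congr_fun measurableSet_Ioc fun s hs => by
          rw [causalConv_eq_setIntegral_indicator w z hs.2,
            ← integral_inner (integrableOn_indicator_smul hw hz s)]
          simp only [inner_smul_right, W]
    _ = ∫ y in Ioc 0 t, ∫ s in Ioc 0 t, W (s - y) * inner ℝ (v (t - s)) (z y) :=
        integral_integral_swap (integrable_indicator_mul_inner hw hv hz)
    _ = ∫ y in Ioc 0 t, ∫ r in Ioc 0 t, W (t - y - r) * inner ℝ (v r) (z y) :=
        setIntegral_congr_fun measurableSet_Ioc fun y _ => by
          rw [← setIntegral_Ioc_comp_sub_left]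
          simp only [sub_sub_cancel, sub_right_comm]
    _ = ∫ y in Ioc 0 t, inner ℝ (causalConv w v (t - y)) (z y) :=
        setIntegral_congr_fun measurableSet_Ioc fun y hy => by
          rw [causalConv_eq_setIntegral_indicator w v (sub_le_self t hy.1.le),
            ← integral_inner_left (integrableOn_indicator_smul hw hv _)]
          simp only [real_inner_smul_left, W]

end CausalConvolution

theorem tendsto_coe_nhdsGT_zero :
    Tendsto ((↑) : ℝ≥0 → ℝ) (𝓝[>] 0) (𝓝[>] 0) :=
  NNReal.continuous_coe.continuousWithinAt.tendsto_nhdsWithin fun _ h => NNReal.coe_pos.2 h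

section Semigroup

variable {E : Type*} [NormedAddCommGroup E] [NormedSpace ℝ E] {T : ℝ≥0 → E →L[ℝ] E} {g h x : E}

/-- A strongly continuous semigroup of linear contractions of a normed space. -/
structure IsContractionSemigroup (T : ℝ≥0 → E →L[ℝ] E) : Prop where
  norm_le : ∀ t, ‖T t‖ ≤ 1
  zero : T 0 = 1
  add : ∀ s t, T (s + t) = T s * T t
  tendsto : ∀ x, Tendsto (fun t => T t x) (𝓝[>] 0) (𝓝 x)

/-- The pair `(g, h)` belongs to the graph of the infinitesimal generator of `T`. -/
def MemGenerator (T : ℝ≥0 → E →L[ℝ] E) (g h : E) : Prop :=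
  Tendsto (fun t : ℝ≥0 => (t : ℝ)⁻¹ • (T t g - g)) (𝓝[>] 0) (𝓝 h)

/-- The integral `∫_0^r T_a x da` of an orbit of `T`. -/
noncomputable def orbitIntegral (T : ℝ≥0 → E →L[ℝ] E) (x : E) (r : ℝ) : E :=
  ∫ a in Ioc 0 r, T a.toNNReal x

theorem orbitIntegral_coe (x : E) (r : ℝ≥0) :
    orbitIntegral T x r = ∫ a in (0 : ℝ)..r, T a.toNNReal x :=
  (intervalIntegral.integral_of_le r.coe_nonneg).symm

namespace IsContractionSemigroup

theorem norm_apply_le (hT : IsContractionSemigroup T) (t : ℝ≥0) (x : E) : ‖T t x‖ ≤ ‖x‖ := by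
  simpa only [one_mul] using (T t).le_of_opNorm_le (hT.norm_le t) x

theorem apply_zero (hT : IsContractionSemigroup T) (x : E) : T 0 x = x := by
  rw [hT.zero, one_apply_eq_self]

theorem apply_add (hT : IsContractionSemigroup T) (s t : ℝ≥0) (x : E) :
    T (s + t) x = T s (T t x) := by
  rw [hT.add, mul_apply_eq_comp]

theorem dist_apply_le (hT : IsContractionSemigroup T) {s t : ℝ≥0} (hst : s ≤ t) (x : E) :
    dist (T s x) (T t x) ≤ dist (T (t - s) x) x := by
  rw [← add_tsub_cancel_of_le hst, hT.apply_add, add_tsub_cancel_left, dist_comm, dist_eq_norm,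
    ← map_sub, dist_eq_norm]
  exact hT.norm_apply_le s _

theorem continuous_orbit (hT : IsContractionSemigroup T) (x : E) : Continuous fun t => T t x := by
  refine Metric.continuous_iff.2 fun t ε hε => ?_
  obtain ⟨δ, hδ, hsmall⟩ := Metric.tendsto_nhdsWithin_nhds.1 (hT.tendsto x) ε hε
  have hclose : ∀ {s r : ℝ≥0}, s ≤ r → dist r s < δ → dist (T s x) (T r x) < ε := by
    intro s r hsr hdist
    rcases hsr.eq_or_lt with rfl | hlt
    · rwa [dist_self]
    · refine (hT.dist_apply_le hsr x).trans_lt (hsmall (tsub_pos_of_lt hlt) ?_)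
      rwa [NNReal.dist_eq, NNReal.coe_sub hsr, NNReal.coe_zero, sub_zero]
  refine ⟨δ, hδ, fun s hs => ?_⟩
  rcases le_total s t with hst | hts
  · exact hclose hst (by rwa [dist_comm])
  · rw [dist_comm]
    exact hclose hts hs

theorem continuous_orbit_toNNReal (hT : IsContractionSemigroup T) (x : E) :
    Continuous fun a : ℝ => T a.toNNReal x :=
  (hT.continuous_orbit x).comp continuous_real_toNNReal

theorem norm_orbitIntegral_le (hT : IsContractionSemigroup T) (x : E) (r : ℝ≥0) :
    ‖orbitIntegral T x r‖ ≤ r * ‖x‖ := by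
  refine (norm_setIntegral_le_of_norm_le_const (C := ‖x‖) measure_Ioc_lt_top
    fun a _ => hT.norm_apply_le _ x).trans_eq ?_
  rw [Real.volume_real_Ioc_of_le r.coe_nonneg, sub_zero, mul_comm]

theorem continuous_orbitIntegral (hT : IsContractionSemigroup T) (x : E) :
    Continuous fun r : ℝ≥0 => orbitIntegral T x r := by
  simp only [orbitIntegral_coe]
  exact (intervalIntegral.continuous_primitive
    (hT.continuous_orbit_toNNReal x).intervalIntegrable 0).comp NNReal.continuous_coe

theorem hasDerivWithinAt_orbit (hT : IsContractionSemigroup T) (hg : MemGenerator T g h) {r : ℝ}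
    (hr : 0 ≤ r) :
    HasDerivWithinAt (fun a : ℝ => T a.toNNReal g) (T r.toNNReal h) (Ioi r) r := by
  rw [hasDerivWithinAt_iff_tendsto_slope' self_notMem_Ioi]
  have hshift : Tendsto (fun y : ℝ => (y - r).toNNReal) (𝓝[>] r) (𝓝[>] 0) := by
    have hcont : Continuous fun y : ℝ => (y - r).toNNReal := by fun_prop
    simpa only [sub_self, Real.toNNReal_zero] using
      (hcont.continuousWithinAt (s := Ioi r) (x := r)).tendsto_nhdsWithin
        (t := Ioi (r - r).toNNReal) fun y hy => by simpa using hy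
  refine (((T r.toNNReal).continuous.tendsto h).comp (hg.comp hshift)).congr' ?_
  filter_upwards [self_mem_nhdsWithin] with y (hy : r < y)
  have hsplit : y.toNNReal = r.toNNReal + (y - r).toNNReal := by
    rw [← Real.toNNReal_add hr (sub_nonneg.2 hy.le), add_sub_cancel]
  simp only [Function.comp_apply, Real.coe_toNNReal _ (sub_nonneg.2 hy.le), slope, hsplit,
    hT.apply_add, map_smul, map_sub, vsub_eq_sub]

variable [CompleteSpace E]

theorem orbitIntegral_add (hT : IsContractionSemigroup T) (x : E) (r s : ℝ≥0) :
    orbitIntegral T x (r + s : ℝ≥0) = orbitIntegral T x r + T r (orbitIntegral T x s) := by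
  have hint := fun p q => (hT.continuous_orbit_toNNReal x).intervalIntegrable (μ := volume) p q
  have hshift : T r (∫ a in (0 : ℝ)..s, T a.toNNReal x)
      = ∫ a in (r : ℝ)..(r + s), T a.toNNReal x := by
    have h := intervalIntegral.integral_comp_add_right (a := 0) (b := s)
      (fun a => T a.toNNReal x) (r : ℝ)
    rw [zero_add, add_comm (s : ℝ)] at h
    rw [← (T r).intervalIntegral_comp_comm (hint 0 s), ← h]
    refine intervalIntegral.integral_congr fun a ha => ?_
    rw [uIcc_of_le s.coe_nonneg] at ha
    simp only [Real.toNNReal_add ha.1 r.coe_nonneg, Real.toNNReal_coe, add_comm _ r, hT.apply_add]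
  rw [orbitIntegral_coe, orbitIntegral_coe, orbitIntegral_coe, hshift, NNReal.coe_add]
  exact (intervalIntegral.integral_add_adjacent_intervals (hint _ _) (hint _ _)).symm

theorem map_orbitIntegral_sub (hT : IsContractionSemigroup T) (x : E) (r s : ℝ≥0) :
    T s (orbitIntegral T x r) - orbitIntegral T x r
      = T r (orbitIntegral T x s) - orbitIntegral T x s := by
  have h := hT.orbitIntegral_add x r s
  rw [add_comm r s, hT.orbitIntegral_add x s r] at h
  rw [sub_eq_sub_iff_add_eq_add, add_comm, h, add_comm]

theorem tendsto_smul_orbitIntegral (hT : IsContractionSemigroup T) (x : E) :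
    Tendsto (fun s : ℝ≥0 => (s : ℝ)⁻¹ • orbitIntegral T x s) (𝓝[>] 0) (𝓝 x) := by
  have hderiv := ((hT.continuous_orbit_toNNReal x).integral_hasStrictDerivAt 0
    0).hasDerivAt.tendsto_slope_zero_right.comp tendsto_coe_nhdsGT_zero
  rw [Real.toNNReal_zero, hT.apply_zero] at hderiv
  refine hderiv.congr fun s => ?_
  rw [Function.comp_apply, zero_add, intervalIntegral.integral_same, sub_zero,
    orbitIntegral_coe]

theorem orbitIntegral_of_memGenerator (hT : IsContractionSemigroup T) (hg : MemGenerator T g h)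
    (r : ℝ≥0) : orbitIntegral T h r = T r g - g := by
  have hftc := intervalIntegral.integral_eq_sub_of_hasDeriv_right_of_le r.coe_nonneg
    (hT.continuous_orbit_toNNReal g).continuousOn
    (fun a ha => hT.hasDerivWithinAt_orbit hg ha.1.le)
    ((hT.continuous_orbit_toNNReal h).intervalIntegrable 0 r)
  rw [orbitIntegral_coe, hftc, Real.toNNReal_coe, Real.toNNReal_zero,
    hT.apply_zero]

end IsContractionSemigroup

end Semigroup

section Subordination

variable {Ω : Type*} [MeasurableSpace Ω] {σ : ℝ≥0 → Ω → ℝ} {ν : Measure ℝ} {Pr : Measure Ω}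

section Banach

variable {E : Type*} [NormedAddCommGroup E] [NormedSpace ℝ E]
  {T : ℝ≥0 → E →L[ℝ] E}

/-- The orbit `E [T_{E_t} x]` of `x` under the semigroup `T` time-changed by the inverse `E_t` of
`σ`. -/
noncomputable def subordinatedOrbit (T : ℝ≥0 → E →L[ℝ] E) (σ : ℝ≥0 → Ω → ℝ) (Pr : Measure Ω)
    (x : E) (t : ℝ) : E :=
  ∫ ω, T (inverseSubordinator σ t ω) x ∂Pr

/-- The mean `E [∫_0^{E_t} T_a x da]` of the integrated orbit up to the inverse `E_t` of `σ`. -/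
noncomputable def subordinatedIntegral (T : ℝ≥0 → E →L[ℝ] E) (σ : ℝ≥0 → Ω → ℝ) (Pr : Measure Ω)
    (x : E) (t : ℝ) : E :=
  ∫ ω, orbitIntegral T x (inverseSubordinator σ t ω) ∂Pr

namespace IsContractionSemigroup

theorem integrable_orbit [IsFiniteMeasure Pr] (hT : IsContractionSemigroup T) (x : E) {e : Ω → ℝ≥0}
    (he : Measurable e) : Integrable (fun ω => T (e ω) x) Pr :=
  Integrable.of_bound ((hT.continuous_orbit x).comp_stronglyMeasurable
    he.stronglyMeasurable).aestronglyMeasurable ‖x‖ (ae_of_all _ fun _ => hT.norm_apply_le _ x)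

theorem continuous_subordinatedOrbit [IsFiniteMeasure Pr] (hT : IsContractionSemigroup T)
    (hσ : IsRegularSubordinator σ ν Pr) (x : E) : Continuous (subordinatedOrbit T σ Pr x) :=
  continuous_of_dominated
    (fun t => (hT.integrable_orbit x (hσ.measurable_inverse t)).aestronglyMeasurable)
    (fun _ => ae_of_all _ fun _ => hT.norm_apply_le _ x) (integrable_const ‖x‖)
    (ae_of_all _ fun ω => (hT.continuous_orbit x).comp (hσ.path ω).continuous_inverse)

theorem integrable_orbitIntegral (hT : IsContractionSemigroup T)
    (hσ : IsRegularSubordinator σ ν Pr) (x : E) (t : ℝ) :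
    Integrable (fun ω => orbitIntegral T x (inverseSubordinator σ t ω)) Pr :=
  ((hσ.integrable_inverse t).mul_const ‖x‖).mono'
    ((hT.continuous_orbitIntegral x).comp_stronglyMeasurable
      (hσ.measurable_inverse t).stronglyMeasurable).aestronglyMeasurable
    (ae_of_all _ fun _ => hT.norm_orbitIntegral_le x _)

theorem continuous_subordinatedIntegral (hT : IsContractionSemigroup T)
    (hσ : IsRegularSubordinator σ ν Pr) (x : E) : Continuous (subordinatedIntegral T σ Pr x) := by
  refine continuous_iff_continuousAt.2 fun t => continuousAt_of_dominated
    (Eventually.of_forall fun s => (hT.integrable_orbitIntegral hσ x s).aestronglyMeasurable) ?_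
    ((hσ.integrable_inverse (t + 1)).mul_const ‖x‖)
    (ae_of_all _ fun ω =>
      ((hT.continuous_orbitIntegral x).comp (hσ.path ω).continuous_inverse).continuousAt)
  filter_upwards [Iic_mem_nhds (lt_add_one t)] with s hs
  refine ae_of_all _ fun ω => (hT.norm_orbitIntegral_le x _).trans ?_
  gcongr
  exact (hσ.path ω).inverse_mono hs

variable [IsProbabilityMeasure Pr]

theorem causalConv_subordinatedIntegral (hT : IsContractionSemigroup T)
    (hσ : IsRegularSubordinator σ ν Pr) (x : E) (t : ℝ) :
    causalConv (levyTail ν) (subordinatedIntegral T σ Pr x) t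
      = causalConv 1 (subordinatedOrbit T σ Pr x) t := by
  have h := hσ.integral_levyTail_smul_integral_inverse
    (hT.continuous_orbit_toNNReal x).stronglyMeasurable (fun a => hT.norm_apply_le _ x) t
  simp only [Real.toNNReal_coe] at h
  rw [causalConv_one]
  exact h

variable [CompleteSpace E]

theorem subordinatedOrbit_zero (hT : IsContractionSemigroup T)
    (hσ : IsRegularSubordinator σ ν Pr) (x : E) : subordinatedOrbit T σ Pr x 0 = x := by
  simp only [subordinatedOrbit, (hσ.path _).inverse_of_nonpos le_rfl, hT.apply_zero,
    integral_const, probReal_univ, one_smul]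

theorem memGenerator_subordinatedIntegral (hT : IsContractionSemigroup T)
    (hσ : IsRegularSubordinator σ ν Pr) (x : E) (t : ℝ) :
    MemGenerator T (subordinatedIntegral T σ Pr x t) (subordinatedOrbit T σ Pr x t - x) := by
  set e := inverseSubordinator σ t
  have hincrement (s : ℝ≥0) :
      ∫ ω, (T (e ω) ((s : ℝ)⁻¹ • orbitIntegral T x s) - (s : ℝ)⁻¹ • orbitIntegral T x s) ∂Pr
        = (s : ℝ)⁻¹ •
          (T s (subordinatedIntegral T σ Pr x t) - subordinatedIntegral T σ Pr x t) := by
    have hint := hT.integrable_orbitIntegral hσ x t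
    rw [subordinatedIntegral, ← (T s).integral_comp_comm hint,
      ← integral_sub ((T s).integrable_comp hint) hint, ← integral_smul]
    simp only [hT.map_orbitIntegral_sub, map_smul, ← smul_sub, e]
  have hlimit : ∫ ω, (T (e ω) x - x) ∂Pr = subordinatedOrbit T σ Pr x t - x := by
    rw [integral_sub (hT.integrable_orbit x (hσ.measurable_inverse t)) (integrable_const x),
      integral_const, probReal_univ, one_smul, subordinatedOrbit]
  have hnorm (s : ℝ≥0) : ‖(s : ℝ)⁻¹ • orbitIntegral T x s‖ ≤ ‖x‖ := by
    rw [norm_smul, norm_inv, Real.norm_of_nonneg s.coe_nonneg]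
    exact inv_mul_le_of_le_mul₀ s.coe_nonneg (norm_nonneg x) (hT.norm_orbitIntegral_le x s)
  rw [MemGenerator, ← hlimit]
  simp only [← hincrement]
  refine tendsto_integral_filter_of_dominated_convergence (fun _ => ‖x‖ + ‖x‖)
    (Eventually.of_forall fun s => ?_) (Eventually.of_forall fun s => ae_of_all _ fun ω => ?_)
    (integrable_const _) (ae_of_all _ fun ω => ?_)
  · exact ((hT.integrable_orbit _ (hσ.measurable_inverse t)).sub
      (integrable_const _)).aestronglyMeasurable
  · exact (norm_sub_le _ _).trans
      (add_le_add ((hT.norm_apply_le _ _).trans (hnorm s)) (hnorm s))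
  · exact (((T (e ω)).continuous.tendsto x).comp (hT.tendsto_smul_orbitIntegral x)).sub
      (hT.tendsto_smul_orbitIntegral x)

theorem subordinatedIntegral_of_memGenerator (hT : IsContractionSemigroup T)
    (hσ : IsRegularSubordinator σ ν Pr) {g h : E} (hg : MemGenerator T g h) (t : ℝ) :
    subordinatedIntegral T σ Pr h t = subordinatedOrbit T σ Pr g t - g := by
  simp only [subordinatedIntegral, hT.orbitIntegral_of_memGenerator hg]
  rw [integral_sub (hT.integrable_orbit g (hσ.measurable_inverse t)) (integrable_const g),
    integral_const, probReal_univ, one_smul, subordinatedOrbit]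

end IsContractionSemigroup

end Banach

end Subordination

section WeakSolution

variable {H : Type*} [NormedAddCommGroup H] [InnerProductSpace ℝ H] {T : ℝ≥0 → H →L[ℝ] H}
  {w : ℝ → ℝ} {f : H} {u v : ℝ → H}

/-- Weak solutions `u` of `∂_t^w u = L u`, `u(0) = f`, for the (symmetric) generator `L` of a
semigroup `T` on an arbitrary Hilbert space. -/
structure IsAbstractWeakSolution (T : ℝ≥0 → H →L[ℝ] H) (w : ℝ → ℝ) (f : H) (u : ℝ → H) :
    Prop where
  initial : u 0 = f
  continuousOn : ContinuousOn u (Ici 0)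
  hasDerivAt : ∀ g h, MemGenerator T g h → ∀ t : ℝ, 0 < t →
    HasDerivAt (fun r => inner ℝ g (causalConv w (fun s => u s - f) r)) (inner ℝ (u t) h) t

variable [CompleteSpace H]

theorem IsAbstractWeakSolution.inner_causalConv_sub (hu : IsAbstractWeakSolution T w f u)
    (hw : ∀ t, IntegrableOn w (Ioc 0 t)) {g h : H} (hg : MemGenerator T g h) {t : ℝ}
    (ht : 0 ≤ t) :
    inner ℝ g (causalConv w (fun s => u s - f) t) = inner ℝ (causalConv 1 u t) h := by
  have hcont : ContinuousOn (fun s => inner ℝ (u s) h) (Ici 0) :=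
    hu.continuousOn.inner continuousOn_const
  have hint : IntegrableOn u (Ioc 0 t) :=
    (hu.continuousOn.mono Icc_subset_Ici_self).integrableOn_Icc.mono_set Ioc_subset_Icc_self
  have hzero := tendsto_const_nhds.inner (𝕜 := ℝ) (x := g)
    (tendsto_causalConv_zero hw (hu.continuousOn.fun_sub (continuousOn_const (c := f))))
  rw [causalConv_one, ← integral_inner_left hint]
  rcases ht.eq_or_lt with rfl | ht
  · simp only [causalConv, Ioc_self, setIntegral_empty, inner_zero_right]
  · have hftc := intervalIntegral.integral_eq_sub_of_hasDerivAt_of_tendsto ht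
      (fun s hs => hu.hasDerivAt g h hg s hs.1)
      ((hcont.mono Icc_subset_Ici_self).intervalIntegrable_of_Icc ht.le) hzero
      ((hu.hasDerivAt g h hg t ht).continuousAt.tendsto.mono_left nhdsWithin_le_nhds)
    rw [← intervalIntegral.integral_of_le ht.le, hftc, inner_zero_right, sub_zero]

theorem IsAbstractWeakSolution.inner_causalConv_difference (hu : IsAbstractWeakSolution T w f u)
    (hv : IsAbstractWeakSolution T w f v) (hw : ∀ t, IntegrableOn w (Ioc 0 t)) {g h : H}
    (hg : MemGenerator T g h) {t : ℝ} (ht : 0 ≤ t) :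
    inner ℝ g (causalConv w (fun s => u s - v s) t)
      = inner ℝ (causalConv 1 (fun s => u s - v s) t) h := by
  have hsplit : (fun s => u s - v s) = fun s => (u s - f) - (v s - f) := by
    simp only [sub_sub_sub_cancel_right]
  rw [causalConv_sub (integrableOn_one_Ioc t) hu.continuousOn hv.continuousOn, hsplit,
    causalConv_sub (hw t) (hu.continuousOn.fun_sub continuousOn_const)
      (hv.continuousOn.fun_sub continuousOn_const), inner_sub_right, inner_sub_left,
    hu.inner_causalConv_sub hw hg ht, hv.inner_causalConv_sub hw hg ht]

variable {Ω : Type*} [MeasurableSpace Ω] {σ : ℝ≥0 → Ω → ℝ} {ν : Measure ℝ} {Pr : Measure Ω}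
  [IsProbabilityMeasure Pr]

namespace IsContractionSemigroup

theorem inner_subordinatedOrbit (hT : IsContractionSemigroup T)
    (hsymm : ∀ t, (T t : H →ₗ[ℝ] H).IsSymmetric) (hσ : IsRegularSubordinator σ ν Pr) (x y : H)
    (t : ℝ) :
    inner ℝ (subordinatedOrbit T σ Pr x t) y = inner ℝ x (subordinatedOrbit T σ Pr y t) := by
  have he := hσ.measurable_inverse t
  rw [subordinatedOrbit, subordinatedOrbit, ← integral_inner (hT.integrable_orbit y he),
    ← integral_inner_left (hT.integrable_orbit x he)]
  exact integral_congr_ae (ae_of_all _ fun ω => hsymm _ x y)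

theorem inner_causalConv_subordinatedOrbit_sub (hT : IsContractionSemigroup T)
    (hsymm : ∀ t, (T t : H →ₗ[ℝ] H).IsSymmetric) (hσ : IsRegularSubordinator σ ν Pr) (f : H)
    {g h : H} (hg : MemGenerator T g h) (t : ℝ) :
    inner ℝ g (causalConv (levyTail ν) (fun s => subordinatedOrbit T σ Pr f s - f) t)
      = ∫ s in Ioc 0 t, inner ℝ (subordinatedOrbit T σ Pr f s) h := by
  have hw := hσ.levy.integrableOn_levyTail t
  have hcont := fun x => (hT.continuous_subordinatedOrbit hσ x).continuousOn (s := Ici 0)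
  calc inner ℝ g (causalConv (levyTail ν) (fun s => subordinatedOrbit T σ Pr f s - f) t)
      = causalConv (levyTail ν) (fun s => inner ℝ f (subordinatedOrbit T σ Pr g s - g)) t := by
        rw [inner_causalConv g hw ((hcont f).fun_sub continuousOn_const)]
        congr 1 with s
        rw [inner_sub_right, inner_sub_right, ← hT.inner_subordinatedOrbit hsymm hσ g f,
          real_inner_comm, real_inner_comm f g]
    _ = inner ℝ f (causalConv (levyTail ν) (subordinatedIntegral T σ Pr h) t) := by
        simp only [← hT.subordinatedIntegral_of_memGenerator hσ hg]
        rw [inner_causalConv f hw (hT.continuous_subordinatedIntegral hσ h).continuousOn]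
    _ = ∫ s in Ioc 0 t, inner ℝ f (subordinatedOrbit T σ Pr h s) := by
        rw [hT.causalConv_subordinatedIntegral hσ,
          inner_causalConv f (integrableOn_one_Ioc t) (hcont h), causalConv_one]
    _ = ∫ s in Ioc 0 t, inner ℝ (subordinatedOrbit T σ Pr f s) h := by
        simp only [hT.inner_subordinatedOrbit hsymm hσ]

theorem isAbstractWeakSolution_subordinatedOrbit (hT : IsContractionSemigroup T)
    (hsymm : ∀ t, (T t : H →ₗ[ℝ] H).IsSymmetric) (hσ : IsRegularSubordinator σ ν Pr) (f : H) :
    IsAbstractWeakSolution T (levyTail ν) f (subordinatedOrbit T σ Pr f) where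
  initial := hT.subordinatedOrbit_zero hσ f
  continuousOn := (hT.continuous_subordinatedOrbit hσ f).continuousOn
  hasDerivAt g h hg t ht := by
    simp only [hT.inner_causalConv_subordinatedOrbit_sub hsymm hσ f hg]
    exact hasDerivAt_setIntegral_Ioc
      ((hT.continuous_subordinatedOrbit hσ f).inner continuous_const).continuousOn ht

/-- Testing the weak equation for `v` against `z(s) = E [∫_0^{E_s} T_a x da]`, for which
`w * z = 1 * U x` and `L z = U x - x` with `U x = E [T_E x]`, leaves `1 * ⟪1 * v, x⟫ = 0`. -/
theorem eqOn_zero_of_inner_causalConv (hT : IsContractionSemigroup T)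
    (hσ : IsRegularSubordinator σ ν Pr) (hv : ContinuousOn v (Ici 0))
    (hweak : ∀ g h, MemGenerator T g h → ∀ t, 0 ≤ t →
      inner ℝ g (causalConv (levyTail ν) v t) = inner ℝ (causalConv 1 v t) h) :
    EqOn v 0 (Ici 0) := by
  have hV := continuousOn_causalConv_one hv
  refine eqOn_zero_of_causalConv_one_eqOn_zero hv
    (eqOn_zero_of_causalConv_one_eqOn_zero hV fun t _ => ext_inner_right ℝ fun x => ?_)
  set U := subordinatedOrbit T σ Pr x
  set z := subordinatedIntegral T σ Pr x
  have hU : ContinuousOn U (Ici 0) := (hT.continuous_subordinatedOrbit hσ x).continuousOn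
  have hz : ContinuousOn z (Ici 0) := (hT.continuous_subordinatedIntegral hσ x).continuousOn
  have hpair : ∫ s in Ioc 0 t, inner ℝ (causalConv 1 v (t - s)) (U s - x)
      = ∫ s in Ioc 0 t, inner ℝ (causalConv 1 v (t - s)) (U s) :=
    calc ∫ s in Ioc 0 t, inner ℝ (causalConv 1 v (t - s)) (U s - x)
        = ∫ s in Ioc 0 t, inner ℝ (causalConv (levyTail ν) v (t - s)) (z s) :=
          setIntegral_congr_fun measurableSet_Ioc fun s hs => by
            rw [real_inner_comm (z s), hweak _ _ (hT.memGenerator_subordinatedIntegral hσ x s) _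
              (sub_nonneg.2 hs.2)]
      _ = ∫ s in Ioc 0 t, inner ℝ (v (t - s)) (causalConv (levyTail ν) z s) :=
          (setIntegral_inner_causalConv (hσ.levy.integrableOn_levyTail t) hv hz).symm
      _ = ∫ s in Ioc 0 t, inner ℝ (v (t - s)) (causalConv 1 U s) := by
          simp only [z, U, hT.causalConv_subordinatedIntegral hσ]
      _ = ∫ s in Ioc 0 t, inner ℝ (causalConv 1 v (t - s)) (U s) :=
          setIntegral_inner_causalConv (integrableOn_one_Ioc t) hv hU
  have hint {y : ℝ → H} (hy : ContinuousOn y (Ici 0)) :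
      IntegrableOn (fun s => inner ℝ (causalConv 1 v (t - s)) (y s)) (Ioc 0 t) :=
    (ContinuousOn.integrableOn_Icc (ContinuousOn.inner
      (hV.comp (by fun_prop) fun s hs => sub_nonneg.2 hs.2)
      (hy.mono Icc_subset_Ici_self))).mono_set Ioc_subset_Icc_self
  simp only [inner_sub_right] at hpair
  rw [integral_sub (hint hU) (hint continuousOn_const), sub_eq_self,
    setIntegral_Ioc_comp_sub_left (fun s => inner ℝ (causalConv 1 v s) x)] at hpair
  rw [Pi.zero_apply, inner_zero_left, causalConv_one, ← integral_inner_left, hpair]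
  exact (hV.mono Icc_subset_Ici_self).integrableOn_Icc.mono_set Ioc_subset_Icc_self

theorem eqOn_subordinatedOrbit (hT : IsContractionSemigroup T)
    (hsymm : ∀ t, (T t : H →ₗ[ℝ] H).IsSymmetric) (hσ : IsRegularSubordinator σ ν Pr)
    (hv : IsAbstractWeakSolution T (levyTail ν) f v) :
    EqOn v (subordinatedOrbit T σ Pr f) (Ici 0) := by
  have hu := hT.isAbstractWeakSolution_subordinatedOrbit hsymm hσ f
  have hzero := hT.eqOn_zero_of_inner_causalConv hσ (hv.continuousOn.sub hu.continuousOn)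
    fun g h hg t ht => hv.inner_causalConv_difference hu hσ.levy.integrableOn_levyTail hg ht
  exact fun t ht => sub_eq_zero.1 (hzero ht)

end IsContractionSemigroup

end WeakSolution

namespace StrongMarkovProcess

section Transition

variable {M Ω : Type*} [MeasurableSpace M] [MeasurableSpace Ω] {X : StrongMarkovProcess M Ω}
  {μ : Measure M}

theorem kernel_apply (X : StrongMarkovProcess M Ω) (t : ℝ≥0) (x : M) :
    X.kernel t x = ((X.P (Sum.inl x)).map (X.X t)).comap Sum.inl := rfl

theorem kernel_apply_apply (X : StrongMarkovProcess M Ω) (t : ℝ≥0) (x : M) {B : Set M}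
    (hB : MeasurableSet B) :
    X.kernel t x B = X.P (Sum.inl x) (X.X t ⁻¹' (Sum.inl '' B)) :=
  X.transition_apply t x hB

theorem kernel_zero (X : StrongMarkovProcess M Ω) (x : M) : X.kernel 0 x = Measure.dirac x := by
  have := X.isProbabilityMeasure (Sum.inl x)
  have hlaw : (X.P (Sum.inl x)).map (X.X 0) = Measure.dirac (Sum.inl x) := by
    rw [Measure.map_congr (X.start (Sum.inl x)), Measure.map_const, measure_univ, one_smul]
  rw [kernel_apply, hlaw, ← Measure.map_dirac' measurable_inl, measurableEmbedding_inl.comap_map]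

theorem prob_cemetery (X : StrongMarkovProcess M Ω) (t : ℝ≥0) (B : Set M) :
    X.P (Sum.inr ()) (X.X t ⁻¹' (Sum.inl '' B)) = 0 := by
  refine measure_eq_zero_iff_ae_notMem.2 ?_
  filter_upwards [X.start (Sum.inr ())] with ω hω
  simp [X.absorbed 0 t ω zero_le hω]

theorem prob_preimage_add (X : StrongMarkovProcess M Ω) (s t : ℝ≥0) (x : M) {B : Set (M ⊕ Unit)}
    (hB : MeasurableSet B) :
    X.P (Sum.inl x) (X.X (s + t) ⁻¹' B)
      = ∫⁻ ω, X.P (X.X s ω) (X.X t ⁻¹' B) ∂X.P (Sum.inl x) := by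
  have h := X.strong_markov (fun _ => (s : WithTop ℝ≥0)) (isStoppingTime_const X.𝓕 s) t
    (Sum.inl x) B univ hB MeasurableSet.univ (fun _ _ => WithTop.coe_ne_top)
  simp only [univ_inter, WithTop.untopD_coe, Measure.restrict_univ] at h
  exact h

theorem kernel_add (X : StrongMarkovProcess M Ω) (s t : ℝ≥0) :
    X.kernel (s + t) = X.kernel t ∘ₖ X.kernel s := by
  ext x B hB
  have hB' : MeasurableSet (Sum.inl '' B : Set (M ⊕ Unit)) := measurableSet_inl_image.2 hB
  set F : M ⊕ Unit → ℝ≥0∞ := fun z => X.P z (X.X t ⁻¹' (Sum.inl '' B))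
  have hF : (range Sum.inl).indicator F = F :=
    indicator_eq_self.2 fun z hz => by
      rcases z with y | u
      · exact mem_range_self y
      · exact absurd (X.prob_cemetery t B) hz
  calc X.kernel (s + t) x B
      = ∫⁻ ω, F (X.X s ω) ∂X.P (Sum.inl x) := by
        rw [X.kernel_apply_apply _ x hB, X.prob_preimage_add s t x hB']
    _ = ∫⁻ z in range Sum.inl, F z ∂(X.P (Sum.inl x)).map (X.X s) := by
        rw [← lintegral_indicator measurableEmbedding_inl.measurableSet_range, hF,
          lintegral_map (X.measurable_prob t _ hB') (X.measurable_X s)]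
    _ = ∫⁻ y, F (Sum.inl y) ∂X.kernel s x := by
        rw [kernel_apply, ← measurableEmbedding_inl.lintegral_map,
          measurableEmbedding_inl.map_comap]
    _ = (X.kernel t ∘ₖ X.kernel s) x B := by
        rw [Kernel.comp_apply' _ _ _ hB]
        exact lintegral_congr fun y => (X.kernel_apply_apply t y hB).symm

theorem enorm_transition_le (X : StrongMarkovProcess M Ω) (t : ℝ≥0) {f : M → ℝ}
    (hf : StronglyMeasurable f) (x : M) :
    ‖X.transition t f x‖ₑ ≤ eLpNorm f 2 (X.kernel t x) :=
  calc ‖X.transition t f x‖ₑ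
      ≤ eLpNorm f 1 (X.kernel t x) := by
        rw [eLpNorm_one_eq_lintegral_enorm]
        exact enorm_integral_le_lintegral_enorm _
    _ ≤ eLpNorm f 2 (X.kernel t x)
          * X.kernel t x univ ^ (1 / (1 : ℝ≥0∞).toReal - 1 / (2 : ℝ≥0∞).toReal) :=
        eLpNorm_le_eLpNorm_mul_rpow_measure_univ one_le_two hf.aestronglyMeasurable
    _ ≤ eLpNorm f 2 (X.kernel t x) :=
        mul_le_of_le_one_right' (ENNReal.rpow_le_one (X.kernel_univ_le t x) (by norm_num))

namespace IsSymmetric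

variable (hX : X.IsSymmetric μ)
include hX

theorem comp_kernel_le (t : ℝ≥0) : X.kernel t ∘ₘ μ ≤ μ :=
  Measure.le_iff.2 fun B hB => by
    have h := hX.lintegral_le t (measurable_one.indicator hB : Measurable (B.indicator 1))
    simpa only [Measure.bind_apply hB (X.kernel t).aemeasurable, lintegral_indicator_one hB]
      using h

theorem ae_ae_kernel (t : ℝ≥0) {p : M → Prop} (h : ∀ᵐ y ∂μ, p y) :
    ∀ᵐ x ∂μ, ∀ᵐ y ∂X.kernel t x, p y :=
  Measure.ae_ae_of_ae_comp (ae_mono (hX.comp_kernel_le t) h)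

theorem ae_memLp_kernel (t : ℝ≥0) (f : Lp ℝ 2 μ) : ∀ᵐ x ∂μ, MemLp f 2 (X.kernel t x) := by
  have hsq := (Lp.memLp f).integrable_sq.mono_measure (hX.comp_kernel_le t)
  filter_upwards [Measure.ae_integrable_of_integrable_comp hsq] with x hx
  exact (memLp_two_iff_integrable_sq (Lp.stronglyMeasurable f).aestronglyMeasurable).2 hx

theorem ae_integrable_kernel (t : ℝ≥0) (f : Lp ℝ 2 μ) : ∀ᵐ x ∂μ, Integrable f (X.kernel t x) :=
  (hX.ae_memLp_kernel t f).mono fun _ hx => hx.integrable one_le_two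

theorem coeFn_T (t : ℝ≥0) (f : Lp ℝ 2 μ) : T hX t f =ᵐ[μ] X.transition t f :=
  MemLp.coeFn_toLp _

theorem T_add (t : ℝ≥0) (f g : Lp ℝ 2 μ) : T hX t (f + g) = T hX t f + T hX t g := by
  refine Lp.ext ?_
  filter_upwards [hX.coeFn_T t (f + g), hX.coeFn_T t f, hX.coeFn_T t g,
    Lp.coeFn_add (T hX t f) (T hX t g), hX.transition_congr t (Lp.coeFn_add f g),
    hX.ae_integrable_kernel t f, hX.ae_integrable_kernel t g] with x hTfg hTf hTg hadd htr hf hg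
  rw [hTfg, hadd, Pi.add_apply, hTf, hTg, htr]
  exact integral_add hf hg

theorem T_smul (t : ℝ≥0) (c : ℝ) (f : Lp ℝ 2 μ) : T hX t (c • f) = c • T hX t f := by
  refine Lp.ext ?_
  filter_upwards [hX.coeFn_T t (c • f), hX.coeFn_T t f, Lp.coeFn_smul c (T hX t f),
    hX.transition_congr t (Lp.coeFn_smul c f)] with x hTcf hTf hsmul htr
  rw [hTcf, hsmul, Pi.smul_apply, hTf, htr]
  exact integral_smul c _

theorem norm_T_le (t : ℝ≥0) (f : Lp ℝ 2 μ) : ‖T hX t f‖ ≤ ‖f‖ := by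
  rw [T, Lp.norm_toLp, Lp.norm_def]
  refine ENNReal.toReal_mono (Lp.eLpNorm_ne_top f) ((ENNReal.rpow_le_rpow_iff two_pos).1 ?_)
  have hf := Lp.stronglyMeasurable f
  have hsq {ρ : Measure M} {g : M → ℝ} : eLpNorm g 2 ρ ^ (2 : ℝ) = ∫⁻ x, ‖g x‖ₑ ^ (2 : ℝ) ∂ρ :=
    eLpNorm_nnreal_pow_eq_lintegral two_ne_zero
  calc eLpNorm (X.transition t f) 2 μ ^ (2 : ℝ)
      = ∫⁻ x, ‖X.transition t f x‖ₑ ^ (2 : ℝ) ∂μ := hsq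
    _ ≤ ∫⁻ x, eLpNorm f 2 (X.kernel t x) ^ (2 : ℝ) ∂μ := by
        gcongr with x
        exact X.enorm_transition_le t hf x
    _ = ∫⁻ x, ∫⁻ y, ‖f y‖ₑ ^ (2 : ℝ) ∂X.kernel t x ∂μ := by simp only [hsq]
    _ ≤ ∫⁻ x, ‖f x‖ₑ ^ (2 : ℝ) ∂μ := hX.lintegral_le t (hf.measurable.enorm.pow_const _)
    _ = eLpNorm f 2 μ ^ (2 : ℝ) := hsq.symm

theorem T_zero (f : Lp ℝ 2 μ) : T hX 0 f = f := by
  refine Lp.ext ?_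
  filter_upwards [hX.coeFn_T 0 f] with x hx
  rw [hx, transition, X.kernel_zero, integral_dirac' _ _ (Lp.stronglyMeasurable f)]

theorem T_comp (s t : ℝ≥0) (f : Lp ℝ 2 μ) : T hX (s + t) f = T hX s (T hX t f) := by
  refine Lp.ext ?_
  filter_upwards [hX.coeFn_T (s + t) f, hX.coeFn_T s (T hX t f),
    hX.transition_congr s (hX.coeFn_T t f), hX.ae_integrable_kernel (s + t) f]
    with x hst hs ht hf
  rw [X.kernel_add s t] at hf
  rw [hst, hs, ht, transition, X.kernel_add s t]
  exact Kernel.integral_comp hf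

theorem T_nonneg (t : ℝ≥0) {f : Lp ℝ 2 μ} (hf : 0 ≤ f) : 0 ≤ T hX t f := by
  refine (Lp.coeFn_nonneg _).1 ?_
  filter_upwards [hX.coeFn_T t f, hX.ae_ae_kernel t ((Lp.coeFn_nonneg f).2 hf)] with x hx hpos
  exact hx ▸ integral_nonneg_of_ae hpos

theorem ofReal_T (t : ℝ≥0) {f : Lp ℝ 2 μ} (hf : 0 ≤ f) :
    (fun x => ENNReal.ofReal (T hX t f x))
      =ᵐ[μ] fun x => ∫⁻ y, ENNReal.ofReal (f y) ∂X.kernel t x := by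
  filter_upwards [hX.coeFn_T t f, hX.ae_ae_kernel t ((Lp.coeFn_nonneg f).2 hf),
    hX.ae_integrable_kernel t f] with x hx hpos hint
  rw [hx, transition, ofReal_integral_eq_lintegral_ofReal hint hpos]

end IsSymmetric

end Transition

section Inner

variable {M : Type*} [MeasurableSpace M] {μ : Measure M}

theorem integral_mul_eq_inner (f g : Lp ℝ 2 μ) : ∫ x, f x * g x ∂μ = inner ℝ f g := by
  rw [L2.inner_def]
  refine integral_congr_ae (ae_of_all _ fun x => ?_)
  simp [mul_comm]

theorem inner_eq_toReal_lintegral {f g : Lp ℝ 2 μ} (hf : 0 ≤ f) (hg : 0 ≤ g) :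
    inner ℝ f g = (∫⁻ x, ENNReal.ofReal (f x) * ENNReal.ofReal (g x) ∂μ).toReal := by
  rw [← integral_mul_eq_inner, integral_eq_lintegral_of_nonneg_ae]
  · refine congrArg _ (lintegral_congr_ae ?_)
    filter_upwards [(Lp.coeFn_nonneg f).2 hf] with x hx
    exact ENNReal.ofReal_mul hx
  · filter_upwards [(Lp.coeFn_nonneg f).2 hf, (Lp.coeFn_nonneg g).2 hg] with x hfx hgx
    exact mul_nonneg hfx hgx
  · exact (Lp.aestronglyMeasurable f).mul (Lp.aestronglyMeasurable g)

end Inner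

section Semigroup

variable {M Ω : Type*} [MeasurableSpace M] [MeasurableSpace Ω] {X : StrongMarkovProcess M Ω}
  {μ : Measure M}

namespace IsSymmetric

variable (hX : X.IsSymmetric μ)
include hX

theorem inner_T_of_nonneg (t : ℝ≥0) {f g : Lp ℝ 2 μ} (hf : 0 ≤ f) (hg : 0 ≤ g) :
    inner ℝ (T hX t f) g = inner ℝ f (T hX t g) := by
  have hsymm := hX t (fun x => ENNReal.ofReal (f x)) (fun x => ENNReal.ofReal (g x))
    (Lp.stronglyMeasurable f).measurable.ennreal_ofReal
    (Lp.stronglyMeasurable g).measurable.ennreal_ofReal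
  rw [inner_eq_toReal_lintegral (hX.T_nonneg t hf) hg,
    inner_eq_toReal_lintegral hf (hX.T_nonneg t hg)]
  refine congrArg _ ((lintegral_congr_ae ?_).trans (hsymm.trans (lintegral_congr_ae ?_)))
  · exact (hX.ofReal_T t hf).fun_mul (EventuallyEq.refl _ _)
  · exact (EventuallyEq.refl _ _).fun_mul (hX.ofReal_T t hg).symm

/-- The operator `T_t` as a continuous linear endomorphism of `L²(M; μ)`. -/
noncomputable def transitionCLM (t : ℝ≥0) : Lp ℝ 2 μ →L[ℝ] Lp ℝ 2 μ :=
  LinearMap.mkContinuous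
    { toFun := T hX t
      map_add' := hX.T_add t
      map_smul' := hX.T_smul t } 1 fun f => (hX.norm_T_le t f).trans_eq (one_mul _).symm

theorem isSymmetric_transitionCLM (t : ℝ≥0) :
    (hX.transitionCLM t : Lp ℝ 2 μ →ₗ[ℝ] Lp ℝ 2 μ).IsSymmetric := fun f g => by
  change inner ℝ (hX.transitionCLM t f) g = inner ℝ f (hX.transitionCLM t g)
  have hnonneg {f g : Lp ℝ 2 μ} (hf : 0 ≤ f) (hg : 0 ≤ g) :
      inner ℝ (hX.transitionCLM t f) g = inner ℝ f (hX.transitionCLM t g) :=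
    hX.inner_T_of_nonneg t hf hg
  rw [← posPart_sub_negPart f, ← posPart_sub_negPart g]
  simp only [map_sub, inner_sub_left, inner_sub_right,
    hnonneg (posPart_nonneg f) (posPart_nonneg g), hnonneg (posPart_nonneg f) (negPart_nonneg g),
    hnonneg (negPart_nonneg f) (posPart_nonneg g), hnonneg (negPart_nonneg f) (negPart_nonneg g)]

theorem isContractionSemigroup_transitionCLM (hT : IsStronglyContinuous hX) :
    IsContractionSemigroup hX.transitionCLM where
  norm_le _ := LinearMap.mkContinuous_norm_le _ zero_le_one _
  zero := ContinuousLinearMap.ext hX.T_zero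
  add s t := ContinuousLinearMap.ext (hX.T_comp s t)
  tendsto := hT

theorem isWeakSolution_iff {w : ℝ → ℝ} {f : Lp ℝ 2 μ} {u : ℝ → Lp ℝ 2 μ} :
    IsWeakSolution hX w f u ↔ IsAbstractWeakSolution hX.transitionCLM w f u := by
  have hderiv (g h : Lp ℝ 2 μ) (t : ℝ) :
      HasDerivAt (fun r => ∫ x, g x * fracIntegral w f u r x ∂μ) (∫ x, u t x * h x ∂μ) t
        ↔ HasDerivAt (fun r => inner ℝ g (causalConv w (fun s => u s - f) r))
          (inner ℝ (u t) h) t := by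
    simp only [integral_mul_eq_inner]
    rfl
  exact ⟨fun hu => ⟨hu.initial, hu.continuousOn, fun g h hg t ht =>
      (hderiv g h t).1 (hu.hasDerivAt g h hg t ht)⟩,
    fun hu => ⟨hu.initial, hu.continuousOn, fun g h hg t ht =>
      (hderiv g h t).2 (hu.hasDerivAt g h hg t ht)⟩⟩

end IsSymmetric

end Semigroup

end StrongMarkovProcess

theorem inverseSubordinator_congr {Ω : Type*} {S σ : ℝ≥0 → Ω → ℝ} {ω : Ω}
    (h : ∀ t, σ t ω = S t ω) (t : ℝ) :
    inverseSubordinator σ t ω = inverseSubordinator S t ω := by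
  simp only [inverseSubordinator, h]

theorem theorem2p4_general {M Ω Ω' : Type*} [MeasurableSpace M] [MeasurableSpace Ω]
    [MeasurableSpace Ω'] (μ : Measure M) (X : StrongMarkovProcess M Ω) (hX : X.IsSymmetric μ)
    (hT : StrongMarkovProcess.IsStronglyContinuous hX)
    (ν : Measure ℝ) (hν : ν (Ioi 0) = ∞)
    (Pr : Measure Ω') [IsProbabilityMeasure Pr] (S : ℝ≥0 → Ω' → ℝ)
    (hS : IsDriftlessSubordinator S ν Pr) (f : Lp ℝ 2 μ) :
    (∀ t : ℝ, 0 ≤ t →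
      Integrable (fun ω => StrongMarkovProcess.T hX (inverseSubordinator S t ω) f) Pr) ∧
    StrongMarkovProcess.IsWeakSolution hX (levyTail ν) f
      (StrongMarkovProcess.subordinate hX S Pr f) ∧
    (∀ t : ℝ, 0 < t → IntegrableOn
      (fun s => levyTail ν (t - s) • (StrongMarkovProcess.subordinate hX S Pr f s - f))
      (Ioc 0 t)) ∧
    (∀ u : ℝ → Lp ℝ 2 μ, StrongMarkovProcess.IsWeakSolution hX (levyTail ν) f u →
      ∀ t : ℝ, 0 ≤ t → u t = StrongMarkovProcess.subordinate hX S Pr f t) := by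
  have hsg := hX.isContractionSemigroup_transitionCLM hT
  have hsymm := hX.isSymmetric_transitionCLM
  obtain ⟨σ, hσ, hσS⟩ := hS.exists_regular_modification hν
  have horbit (t : ℝ) : (fun ω => hX.transitionCLM (inverseSubordinator σ t ω) f)
      =ᵐ[Pr] fun ω => hX.transitionCLM (inverseSubordinator S t ω) f := by
    filter_upwards [hσS] with ω hω
    rw [inverseSubordinator_congr hω]
  have hsub : subordinatedOrbit hX.transitionCLM σ Pr f
      = StrongMarkovProcess.subordinate hX S Pr f :=
    funext fun t => integral_congr_ae (horbit t)
  have hcont := (hsg.continuous_subordinatedOrbit hσ f).continuousOn (s := Ici 0)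
  simp only [hX.isWeakSolution_iff, ← hsub]
  exact ⟨fun t _ => (hsg.integrable_orbit f (hσ.measurable_inverse t)).congr (horbit t),
    hsg.isAbstractWeakSolution_subordinatedOrbit hsymm hσ f,
    fun t _ => integrableOn_causalConv (hσ.levy.integrableOn_levyTail t)
      (hcont.fun_sub continuousOn_const),
    fun u hu t ht => hsg.eqOn_subordinatedOrbit hsymm hσ hu ht⟩

theorem theorem2p4 {M Ω Ω' : Type*} [TopologicalSpace M] [T2Space M] [LocallyCompactSpace M]
    [MeasurableSpace M] [BorelSpace M] [MeasurableSpace Ω] [MeasurableSpace Ω']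
    (μ : Measure M) [SigmaFinite μ] [μ.IsOpenPosMeasure]
    (X : StrongMarkovProcess M Ω) (hX : X.IsSymmetric μ)
    (hT : StrongMarkovProcess.IsStronglyContinuous hX)
    (ν : Measure ℝ) (hν : ν (Ioi 0) = ∞)
    (Pr : Measure Ω') [IsProbabilityMeasure Pr] (S : ℝ≥0 → Ω' → ℝ)
    (hS : IsDriftlessSubordinator S ν Pr) (f : Lp ℝ 2 μ) :
    (∀ t : ℝ, 0 ≤ t →
      Integrable (fun ω => StrongMarkovProcess.T hX (inverseSubordinator S t ω) f) Pr) ∧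
    StrongMarkovProcess.IsWeakSolution hX (levyTail ν) f
      (StrongMarkovProcess.subordinate hX S Pr f) ∧
    (∀ t : ℝ, 0 < t → IntegrableOn
      (fun s => levyTail ν (t - s) • (StrongMarkovProcess.subordinate hX S Pr f s - f))
      (Ioc 0 t)) ∧
    (∀ u : ℝ → Lp ℝ 2 μ, StrongMarkovProcess.IsWeakSolution hX (levyTail ν) f u →
      ∀ t : ℝ, 0 ≤ t → u t = StrongMarkovProcess.subordinate hX S Pr f t) :=
  theorem2p4_general μ X hX hT ν hν Pr S hS f
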